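/- Let $A$ be an abelian group. Let $A\wr\mathfrak S_n=A^n\rtimes\mathfrak S_n$ be the wreath product, with $\sigma\cdot(a_1,\dots,a_n)=(a_{\sigma^{-1}(1)},\dots,a_{\sigma^{-1}(n)})\cdot\sigma$, and put $\mathscr F_n(\mathbb ZA)=(\mathbb ZA)^{\otimes n}\otimes\mathbb Z\mathfrak S_n=\mathbb Z[A\wr\mathfrak S_n]$. Equip $\mathscr F(\mathbb ZA)=\bigoplus_{n\ge0}\mathscr F_n(\mathbb ZA)$ with the bilinear external product given, for $u\in A\wr\mathfrak S_m$ and $v\in A\wr\mathfrak S_n$, by $$u*v=\Bigl(\sum_{\rho\in X_{(m,n)}}\rho\Bigr)\cdot(u\times v),$$ where $u\times v$ is the image of $(u,v)$ under the standard embedding $(A\wr\mathfrak S_m)\times(A\wr\mathfrak S_n)\hookrightarrow A\wr\mathfrak S_{m+n}$ and $X_{(m,n)}$ is the set of all $\rho\in\mathfrak S_{m+n}$ that are increasing on $\{1,\dots,m\}$ and on $\{m+1,\dots,m+n\}$. For $a\in A$ put $y_{n,a}=(a,\dots,a)\cdot e_n\in\mathscr F_n(\mathbb ZA)$, with $e_n$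 the unit of $\mathfrak S_n$, and extend $v\mapsto y_{n,v}$ linearly to $v\in\mathbb ZA$. Let $\mathrm{MR}(\mathbb ZA)$ be the unital subalgebra of $(\mathscr F(\mathbb ZA),*)$ generated by all the $y_{n,v}$, and $\mathrm{MR}_n(\mathbb ZA)=\mathrm{MR}(\mathbb ZA)\cap\mathscr F_n(\mathbb ZA)$. Let $G$ be a finite abelian group. For a finite group $H$ let $R(H)\subset\mathbb C^H$ be the $\mathbb Z$-span of the characters of the finite-dimensional complex representations of $H$. Let $\mathrm{Rep}(G)=\bigoplus_{n\ge0}R(G\wr\mathfrak S_n)$ with the induction product $$\psi*\psi'=\mathrm{Ind}_{(G\wr\mathfrak S_m)\times(G\wr\mathfrak S_n)}^{G\wr\mathfrak S_{m+n}}(\psi\otimes\psi').$$ For a linear character $\gamma$ of $G$ let $\eta_n(\gamma)$ be the linear character $(g_1,\dots,g_n)\cdot\sigma\mapsto\gamma(g_1\cdots g_n)$ of $G\wr\mathfrak S_n$. Let $\Gamma=\mathrm{Hom}(G,\mathbb C^\times)$ be the dual group of $G$. Identify $G$ with the dual group of $\Gamma$, an element $g\in G$ being the character $\gamma\mapsto\gamma(g)$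 of $\Gamma$. Then: * There is a unique homomorphism of unital algebras $\theta_G:\mathrm{MR}(\mathbb Z\Gamma)\to\mathrm{Rep}(G)$, for the products $*$, such that $\theta_G(y_{n,\gamma})=\eta_n(\gamma)$ for all $n\ge1$ and $\gamma\in\Gamma$. Likewise there is a unique homomorphism of unital algebras $\theta_\Gamma:\mathrm{MR}(\mathbb ZG)\to\mathrm{Rep}(\Gamma)$ such that $\theta_\Gamma(y_{n,g})=\eta_n(g)$ for all $n\ge1$ and $g\in G$. These are the Solomon homomorphisms. * For all $n\ge1$, $x\in\mathrm{MR}_n(\mathbb ZG)$ and $y\in\mathrm{MR}_n(\mathbb Z\Gamma)$, $$\theta_G(y)(x)=\theta_\Gamma(x)(y).$$ Here $\theta_G(y)$, a complex function on $G\wr\mathfrak S_n$ (the degree-$n$ component), is extended $\mathbb Z$-linearly to $\mathbb Z[G\wr\mathfrak S_n]\ni x$, and $\theta_\Gamma(x)$ is likewise extended to $\mathbb Z[\Gamma\wr\mathfrak S_n]\ni y$. -/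

import Mathlib

open scoped DirectSum

noncomputable section

namespace MantaciReutenauer

/-! ### Wreath products and their Young subgroups -/

/-- The wreath product `A ≀ 𝔖ₙ = Aⁿ ⋊ 𝔖ₙ`, where `σ` acts on `Aⁿ` by
`(a₁, …, aₙ) ↦ (a_{σ⁻¹(1)}, …, a_{σ⁻¹(n)})`. The pair `⟨a, σ⟩` is the product `a · σ`. -/
abbrev Wreath (A : Type*) [Group A] (n : ℕ) : Type _ :=
  (Fin n → A) ⋊[mulAutArrow] Equiv.Perm (Fin n)

instance (A : Type*) [Group A] [Finite A] (n : ℕ) : Finite (Wreath A n) :=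
  Finite.of_equiv _ SemidirectProduct.equivProd.symm

/-- The permutation `σ × τ` of `m + n` letters: `σ` on the first `m` letters and
`τ`, shifted by `m`, on the last `n` letters. -/
def permProd {m n : ℕ} (σ : Equiv.Perm (Fin m)) (τ : Equiv.Perm (Fin n)) :
    Equiv.Perm (Fin (m + n)) :=
  finSumFinEquiv.permCongr (Equiv.sumCongr σ τ)

@[simp] lemma permProd_castAdd {m n : ℕ} (σ : Equiv.Perm (Fin m)) (τ : Equiv.Perm (Fin n))
    (i : Fin m) : permProd σ τ (Fin.castAdd n i) = Fin.castAdd n (σ i) := by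
  simp [permProd, Equiv.permCongr_apply]

@[simp] lemma permProd_natAdd {m n : ℕ} (σ : Equiv.Perm (Fin m)) (τ : Equiv.Perm (Fin n))
    (i : Fin n) : permProd σ τ (Fin.natAdd m i) = Fin.natAdd m (τ i) := by
  simp [permProd, Equiv.permCongr_apply]

lemma permProd_mul {m n : ℕ} (σ σ' : Equiv.Perm (Fin m)) (τ τ' : Equiv.Perm (Fin n)) :
    permProd (σ * σ') (τ * τ') = permProd σ τ * permProd σ' τ' := by
  ext i
  refine Fin.addCases (fun i => ?_) (fun i => ?_) i <;> simp

lemma permProd_inv {m n : ℕ} (σ : Equiv.Perm (Fin m)) (τ : Equiv.Perm (Fin n)) :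
    (permProd σ τ)⁻¹ = permProd σ⁻¹ τ⁻¹ := by
  rw [inv_eq_iff_mul_eq_one, ← permProd_mul]
  ext i
  refine Fin.addCases (fun i => ?_) (fun i => ?_) i <;> simp

/-- The embedding `(A ≀ 𝔖ₘ) × (A ≀ 𝔖ₙ) → A ≀ 𝔖ₘ₊ₙ`, whose image is the Young subgroup
`A ≀ 𝔖_{(m,n)}`. -/
def young (A : Type*) [Group A] (m n : ℕ) : Wreath A m × Wreath A n →* Wreath A (m + n) :=
  MonoidHom.mk'
    (fun p => ⟨Fin.append p.1.left p.2.left, permProd p.1.right p.2.right⟩)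
    (by
      intro p q
      refine SemidirectProduct.ext ?_ (permProd_mul _ _ _ _)
      funext i
      change Fin.append (p.1.left * fun j => q.1.left (p.1.right⁻¹ j))
          (p.2.left * fun j => q.2.left (p.2.right⁻¹ j)) i =
        Fin.append p.1.left p.2.left i *
          Fin.append q.1.left q.2.left ((permProd p.1.right p.2.right)⁻¹ i)
      rw [permProd_inv]
      refine Fin.addCases (fun i => ?_) (fun i => ?_) i <;> simp)

/-! ### The free quasisymmetric algebra `ℱ(ℤA)` of a group algebra -/

/-- `ℱₙ(ℤA) = (ℤA)^{⊗n} # ℤ𝔖ₙ`, identified as usual with the group ring `ℤ[A ≀ 𝔖ₙ]`: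
the basis element `(a₁ ⊗ ⋯ ⊗ aₙ) # σ` is the group element `(a₁, …, aₙ) · σ`. -/
abbrev FComp (A : Type*) [Group A] (n : ℕ) : Type _ := MonoidAlgebra ℤ (Wreath A n)

/-- `X_{(m,n)}`: the permutations that increase on the first `m` and on the last `n` letters. -/
def shuffles (m n : ℕ) : Set (Equiv.Perm (Fin (m + n))) :=
  {ρ | StrictMono (fun i : Fin m => ρ (Fin.castAdd n i)) ∧
    StrictMono (fun i : Fin n => ρ (Fin.natAdd m i))}

open Classical in
/-- `x_{(m,n)} = ∑_{ρ ∈ X_{(m,n)}} ρ`, as an element of `ℤ[A ≀ 𝔖ₘ₊ₙ]`. -/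
def shuffleSum (A : Type*) [Group A] (m n : ℕ) : FComp A (m + n) :=
  ∑ ρ : Equiv.Perm (Fin (m + n)),
    if ρ ∈ shuffles m n then MonoidAlgebra.single (SemidirectProduct.inr ρ) 1 else 0

/-- The external product of homogeneous elements,
`[(a₁ ⊗ ⋯ ⊗ aₘ) # σ] * [(b₁ ⊗ ⋯ ⊗ bₙ) # τ]
  = x_{(m,n)} · [(a₁ ⊗ ⋯ ⊗ aₘ ⊗ b₁ ⊗ ⋯ ⊗ bₙ) # (σ × τ)]`, extended bilinearly. -/
def extMul (A : Type*) [Group A] {m n : ℕ} (α : FComp A m) (β : FComp A n) : FComp A (m + n) :=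
  shuffleSum A m n *
    (MonoidAlgebra.mapDomainRingHom ℤ ((young A m n).comp (MonoidHom.inl _ _)) α *
      MonoidAlgebra.mapDomainRingHom ℤ ((young A m n).comp (MonoidHom.inr _ _)) β)

/-- The external product on `⨁ₙ ℱₙ(ℤA)`. -/
instance (A : Type*) [Group A] : DirectSum.GNonUnitalNonAssocSemiring (FComp A) where
  mul α β := extMul A α β
  mul_zero α := by simp [extMul]
  zero_mul β := by simp [extMul]
  mul_add α β γ := by simp only [extMul, map_add, mul_add]
  add_mul α β γ := by simp only [extMul, map_add, mul_add, add_mul]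

instance (A : Type*) [Group A] : GradedMonoid.GOne (FComp A) where
  one := (1 : FComp A 0)

/-- The free quasisymmetric algebra `ℱ(ℤA) = ⨁ₙ ℱₙ(ℤA)` with its external product `*`; the unit
is the basis element of `ℱ₀(ℤA) = ℤ`. -/
abbrev F (A : Type*) [Group A] : Type _ := ⨁ n, FComp A n

/-- `y_{n,v} = δₙ(v) # eₙ ∈ ℱₙ(ℤA)`, where `δₙ : ℤA → (ℤA)^{⊗n}` is the iterated coproduct of
the group algebra, i.e. the linear map with `δₙ(a) = a ⊗ ⋯ ⊗ a` for `a ∈ A`. -/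
def yGen {A : Type*} [Group A] (n : ℕ) (v : MonoidAlgebra ℤ A) : FComp A n :=
  MonoidAlgebra.mapDomain (fun a => (⟨fun _ => a, 1⟩ : Wreath A n)) v

/-- `S` contains the unit and is closed under the external product. -/
def IsExtSubalgebra {A : Type*} [Group A] (S : Submodule ℤ (F A)) : Prop :=
  (1 : F A) ∈ S ∧ ∀ a ∈ S, ∀ b ∈ S, a * b ∈ S

/-- The Mantaci–Reutenauer algebra `MR(ℤA)`: the subalgebra of `ℱ(ℤA)`, for the external product,
generated by the elements `y_{n,v}`. -/
def MR (A : Type*) [Group A] : Submodule ℤ (F A) :=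
  sInf {S | IsExtSubalgebra S ∧
    ∀ (n : ℕ) (v : MonoidAlgebra ℤ A), DirectSum.of (FComp A) n (yGen n v) ∈ S}

lemma one_mem_MR (A : Type*) [Group A] : (1 : F A) ∈ MR A :=
  Submodule.mem_sInf.2 fun _ hS => hS.1.1

lemma mul_mem_MR {A : Type*} [Group A] {a b : F A} (ha : a ∈ MR A) (hb : b ∈ MR A) :
    a * b ∈ MR A :=
  Submodule.mem_sInf.2 fun S hS =>
    hS.1.2 a (Submodule.mem_sInf.1 ha S hS) b (Submodule.mem_sInf.1 hb S hS)

lemma yGen_mem_MR {A : Type*} [Group A] (n : ℕ) (v : MonoidAlgebra ℤ A) :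
    DirectSum.of (FComp A) n (yGen n v) ∈ MR A :=
  Submodule.mem_sInf.2 fun _ hS => hS.2 n v

/-- The homogeneous component `MRₙ(ℤA) = MR(ℤA) ∩ ℱₙ(ℤA)`, inside `ℤ[A ≀ 𝔖ₙ]`. -/
def MRn (A : Type*) [Group A] (n : ℕ) : Submodule ℤ (FComp A n) :=
  (MR A).comap (DirectSum.lof ℤ ℕ (FComp A) n)

/-- The inclusion of `MRₙ(ℤA)` into `MR(ℤA)`. -/
def incl {A : Type*} [Group A] {n : ℕ} (x : MRn A n) : MR A :=
  ⟨DirectSum.lof ℤ ℕ (FComp A) n x, x.2⟩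

/-! ### Representation rings and the induction product -/

/-- The ring `R(H)` of virtual characters: the `ℤ`-span, in the complex-valued functions on `H`, of
the characters of the finite-dimensional complex representations of `H`. -/
def virtualChars (H : Type*) [Group H] : Submodule ℤ (H → ℂ) :=
  Submodule.span ℤ {χ | ∃ (d : ℕ) (ρ : Representation ℂ H (Fin d → ℂ)), χ = ρ.character}

open Classical in
/-- Induction of functions along an injective homomorphism `φ : H → K` of finite groups:
`(Ind f)(g) = (1/|H|) ∑_{k ∈ K, k⁻¹gk ∈ φ(H)} f(φ⁻¹(k⁻¹gk))`. -/
def induce {H K : Type*} [Group H] [Group K] (φ : H →* K) (f : H → ℂ) : K → ℂ :=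
  fun g => (Nat.card H : ℂ)⁻¹ * ∑ᶠ k : K, ∑ᶠ h : H, if φ h = k⁻¹ * g * k then f h else 0

/-- Complex-valued functions on `G ≀ 𝔖ₙ`. -/
abbrev FunComp (G : Type*) [Group G] (n : ℕ) : Type _ := Wreath G n → ℂ

/-- The induction product `ψ * ψ' = Ind (ψ ⊗ ψ')`, from `(G ≀ 𝔖ₘ) × (G ≀ 𝔖ₙ)` to `G ≀ 𝔖ₘ₊ₙ`. -/
def indMul (G : Type*) [Group G] {m n : ℕ} (ψ : FunComp G m) (ψ' : FunComp G n) :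
    FunComp G (m + n) :=
  induce (young G m n) (fun p => ψ p.1 * ψ' p.2)

lemma induce_zero {H K : Type*} [Group H] [Group K] (φ : H →* K) : induce φ 0 = 0 := by
  funext g; simp [induce]

lemma induce_add {H K : Type*} [Group H] [Group K] [Finite H] [Finite K] (φ : H →* K)
    (f f' : H → ℂ) : induce φ (f + f') = induce φ f + induce φ f' := by
  classical
  have := Fintype.ofFinite H
  have := Fintype.ofFinite K
  funext g
  simp only [induce, finsum_eq_sum_of_fintype, Pi.add_apply, ← mul_add, ← Finset.sum_add_distrib]
  congr 1
  refine Finset.sum_congr rfl fun k _ => Finset.sum_congr rfl fun h _ => ?_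
  split_ifs <;> simp

instance (G : Type*) [Group G] [Finite G] :
    DirectSum.GNonUnitalNonAssocSemiring (FunComp G) where
  mul ψ ψ' := indMul G ψ ψ'
  mul_zero ψ := by
    change induce (young G _ _) _ = 0
    rw [← induce_zero (young G _ _)]; congr 1; funext p; simp
  zero_mul ψ := by
    change induce (young G _ _) _ = 0
    rw [← induce_zero (young G _ _)]; congr 1; funext p; simp
  mul_add a b c := by
    simp only [indMul, ← induce_add]; congr 1; funext p; simp [mul_add]
  add_mul a b c := by
    simp only [indMul, ← induce_add]; congr 1; funext p; simp [add_mul]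

instance (G : Type*) [Group G] : GradedMonoid.GOne (FunComp G) where
  one := (1 : FunComp G 0)

/-- `⨁ₙ ℂ^{G ≀ 𝔖ₙ}` with the induction product; the unit is the trivial character of the
one-element group `G ≀ 𝔖₀`. -/
abbrev Fun (G : Type*) [Group G] : Type _ := ⨁ n, FunComp G n

/-- `Rep(G) = ⨁ₙ R(G ≀ 𝔖ₙ)`, inside `⨁ₙ ℂ^{G ≀ 𝔖ₙ}`. -/
def RepRing (G : Type*) [Group G] : Submodule ℤ (Fun G) where
  carrier := {f | ∀ n, f n ∈ virtualChars (Wreath G n)}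
  add_mem' hf hg n := by
    rw [DirectSum.add_apply]; exact Submodule.add_mem _ (hf n) (hg n)
  zero_mem' n := by
    rw [DirectSum.zero_apply]; exact Submodule.zero_mem _
  smul_mem' c f hf n := by
    rw [DirectSum.smul_apply]; exact Submodule.smul_mem _ c (hf n)

/-- For a linear character `χ` of an abelian group `G`, the linear character
`ηₙ(χ) : (g₁, …, gₙ) · σ ↦ χ(g₁ ⋯ gₙ)` of `G ≀ 𝔖ₙ`. -/
def eta {G : Type*} [CommGroup G] (n : ℕ) (χ : G →* ℂˣ) : FunComp G n :=
  fun w => (χ (∏ i, w.left i) : ℂ)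

/-! ### The Solomon homomorphism -/

/-- Let the group `A` be identified with the dual group of the finite abelian group `G`
by means of `e`. The map `θ : MR(ℤA) → Rep(G)` is the Solomon homomorphism of `G` if it is a
homomorphism of unital algebras, for the external product on `MR(ℤA)` and the induction product
on `Rep(G)`, and sends `y_{n,a}` to `ηₙ(e a)` for all `n ≥ 1` and `a ∈ A`. -/
structure IsSolomonHom {A G : Type*} [CommGroup A] [CommGroup G] [Finite G]
    (e : A ≃* (G →* ℂˣ)) (θ : MR A →ₗ[ℤ] RepRing G) : Prop where
  map_one : (θ ⟨1, one_mem_MR A⟩ : Fun G) = 1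
  map_mul : ∀ a b : MR A,
    (θ ⟨a * b, mul_mem_MR a.2 b.2⟩ : Fun G) = (θ a : Fun G) * (θ b : Fun G)
  map_yGen : ∀ (n : ℕ) (a : A), 1 ≤ n →
    (θ ⟨_, yGen_mem_MR n (MonoidAlgebra.single a 1)⟩ : Fun G) =
      DirectSum.of (FunComp G) n (eta n (e a))

/-- The identification of a finite abelian group `G` with the dual of its dual: `g` is the
character `γ ↦ γ(g)`. -/
def biduality (G : Type*) [CommGroup G] [Finite G] : G ≃* ((G →* ℂˣ) →* ℂˣ) :=
  (CommGroup.monoidHomMonoidHomEquiv G ℂ).symm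

lemma biduality_apply (G : Type*) [CommGroup G] [Finite G] (g : G) (γ : G →* ℂˣ) :
    biduality G g γ = γ g := by
  simp [biduality]

/-- The value on an element of `ℤH` of the `ℤ`-linear extension of a function `f : H → ℂ`. -/
def evalAt {H : Type*} (f : H → ℂ) (x : MonoidAlgebra ℤ H) : ℂ :=
  x.coeff.sum fun h c => (c : ℂ) * f h

end MantaciReutenauer

end

noncomputable section

namespace MantaciReutenauer

/-! ### Rearrangements of words -/

/-! The products `y_{k₁,a₁} * ⋯ * y_{k_r,a_r}` span the Mantaci–Reutenauer algebra. Such a product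
is encoded by a monotone word `b`, whose fibres are the blocks, together with a letter of `A` for
each block; it equals `shuffleProd b a`, the sum of the `ρ · a` over all `ρ` increasing on every
block. A triangularity argument (`linearIndependent_toF`) shows that these elements are linearly
independent, so a linear map may be prescribed on them freely. The Solomon homomorphism sends such a
product to `youngInd`, the character induced from a linear character of the Young subgroup of the
blocks. Multiplicativity holds because both products concatenate words
(`IsConcat.extMul_shuffleProd`, `IsConcat.indMul_youngInd`). Uniqueness holds because the `y_{n,a}`
generate.

By bilinearity the symmetry reduces to two such products, with block words `b` and `d`. There the
value is `wordPairing z b d`, where `z i j = χ_j(g_i)`: a weighted count of pairs `(ρ, κ)` with `ρ`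
increasing on the blocks of `b` and `κ` a rearrangement of `d` constant on the cycles of `ρ`. In the
spirit of the Gessel–Reutenauer correspondence, `ρ` is determined by the words in `b` read along its
orbits, and `κ` labels the cycles by letters of `d`. Within each class of points with equal orbit
word, sorting by `κ` produces a second permutation `τ`, which commutes with `ρ` and plays the same
role for `d` as `ρ` does for `b`.

To avoid automorphism factors, the points carry arbitrary labels, ranked by `e` for `b` and by `e'`
for `d`. Then `n!` times the pairing is the weighted number of quadruples `(e, ρ, e', τ)` satisfying
`IsTorusPair` (`factorial_mul_wordPairing`), and that condition is visibly symmetric. The bijection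
rests on `exists_isTorusPair` and `IsTorusPair.unique`. -/

lemma perm_inv_apply_self {α : Type*} (π : Equiv.Perm α) (x : α) : π⁻¹ (π x) = x :=
  π.symm_apply_apply x

lemma perm_apply_inv_self {α : Type*} (π : Equiv.Perm α) (x : α) : π (π⁻¹ x) = x :=
  π.apply_symm_apply x

/-- The rearrangements `b ∘ π` of a word `b`. -/
def arrangements {n : ℕ} (b : Fin n → ℕ) : Finset (Fin n → ℕ) :=
  Finset.univ.image fun π : Equiv.Perm (Fin n) => b ∘ π

lemma mem_arrangements {n : ℕ} {b κ : Fin n → ℕ} :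
    κ ∈ arrangements b ↔ ∃ π : Equiv.Perm (Fin n), b ∘ π = κ := by
  simp [arrangements]

lemma comp_perm_mem_arrangements {n : ℕ} {b κ : Fin n → ℕ} (h : κ ∈ arrangements b)
    (π : Equiv.Perm (Fin n)) : κ ∘ π ∈ arrangements b := by
  obtain ⟨τ, rfl⟩ := mem_arrangements.1 h
  exact mem_arrangements.2 ⟨τ * π, rfl⟩

/-- The order of the stabilizer of a word. -/
def stabCard {n : ℕ} (b : Fin n → ℕ) : ℕ :=
  (Finset.univ.filter fun π : Equiv.Perm (Fin n) => b ∘ π = b).card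

lemma stabCard_pos {n : ℕ} (b : Fin n → ℕ) : 0 < stabCard b :=
  Finset.card_pos.2 ⟨1, by simp⟩

/-- Orbit–stabilizer: each fibre of `π ↦ b ∘ π` is a coset of the stabilizer of `b`. -/
lemma sum_comp_perm {n : ℕ} (b : Fin n → ℕ) (F : (Fin n → ℕ) → ℂ) :
    ∑ π : Equiv.Perm (Fin n), F (b ∘ π) = stabCard b * ∑ κ ∈ arrangements b, F κ := by
  rw [← Finset.sum_fiberwise_of_maps_to (s := Finset.univ) (t := arrangements b)
    (g := fun π : Equiv.Perm (Fin n) => b ∘ π) (fun π _ => mem_arrangements.2 ⟨π, rfl⟩),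
    Finset.mul_sum]
  refine Finset.sum_congr rfl fun κ hκ => ?_
  obtain ⟨τ, rfl⟩ := mem_arrangements.1 hκ
  rw [Finset.sum_congr rfl (g := fun _ => F (b ∘ τ))
    (fun π hπ => by rw [(Finset.mem_filter.1 hπ).2]), Finset.sum_const, nsmul_eq_mul]
  congr 2
  refine Finset.card_bij' (fun π _ => π * τ⁻¹) (fun π _ => π * τ) ?_ ?_ ?_ ?_
  · intro π hπ
    simp only [Finset.mem_filter, Finset.mem_univ, true_and] at hπ ⊢
    funext i
    simpa using congrFun hπ (τ⁻¹ i)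
  · intro π hπ
    simp only [Finset.mem_filter, Finset.mem_univ, true_and] at hπ ⊢
    funext i
    simpa using congrFun hπ (τ i)
  · intro π _; simp
  · intro π _; simp

lemma stabCard_congr {n : ℕ} {b b' : Fin n → ℕ} (h : ∀ i j, b i = b j ↔ b' i = b' j) :
    stabCard b = stabCard b' := by
  simp only [stabCard, funext_iff, Function.comp_apply, h]

/-- `b''` is a concatenation of `b` and `b'` up to an injective renaming of letters, the letters
of the two words being made distinct. -/
structure IsConcat {m n : ℕ} (b : Fin m → ℕ) (b' : Fin n → ℕ) (b'' : Fin (m + n) → ℕ) : Prop where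
  left : ∀ i j, b'' (Fin.castAdd n i) = b'' (Fin.castAdd n j) ↔ b i = b j
  right : ∀ i j, b'' (Fin.natAdd m i) = b'' (Fin.natAdd m j) ↔ b' i = b' j
  cross : ∀ i j, b'' (Fin.castAdd n i) ≠ b'' (Fin.natAdd m j)

lemma IsConcat.comp_permProd {m n : ℕ} {b : Fin m → ℕ} {b' : Fin n → ℕ} {b'' : Fin (m + n) → ℕ}
    (h : IsConcat b b' b'') (σ : Equiv.Perm (Fin m)) (τ : Equiv.Perm (Fin n)) :
    b'' ∘ permProd σ τ = b'' ↔ b ∘ σ = b ∧ b' ∘ τ = b' := by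
  simp only [funext_iff, Function.comp_apply]
  constructor
  · intro H
    refine ⟨fun i => ?_, fun i => ?_⟩
    · rw [← h.left]; simpa using H (Fin.castAdd n i)
    · rw [← h.right]; simpa using H (Fin.natAdd m i)
  · rintro ⟨H, H'⟩ i
    refine Fin.addCases (fun i => ?_) (fun i => ?_) i
    · simpa [h.left] using H i
    · simpa [h.right] using H' i

lemma permProd_injective {m n : ℕ} {σ σ' : Equiv.Perm (Fin m)} {τ τ' : Equiv.Perm (Fin n)}
    (h : permProd σ τ = permProd σ' τ') : σ = σ' ∧ τ = τ' := by
  constructor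
  · ext i
    have := congrArg (fun π => π (Fin.castAdd n i)) h
    simpa [Fin.ext_iff] using this
  · ext i
    have := congrArg (fun π => π (Fin.natAdd m i)) h
    simpa [Fin.ext_iff] using this

/-- The two halves of `b''` share no letter, so a permutation fixing `b''` cannot move a position
from one half to the other. -/
lemma IsConcat.exists_permProd {m n : ℕ} {b : Fin m → ℕ} {b' : Fin n → ℕ}
    {b'' : Fin (m + n) → ℕ} (h : IsConcat b b' b'') {π : Equiv.Perm (Fin (m + n))}
    (hπ : b'' ∘ π = b'') : ∃ σ τ, permProd σ τ = π := by
  have key : finSumFinEquiv.symm.permCongr π ∈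
      Set.range (fun p : Equiv.Perm (Fin m) × Equiv.Perm (Fin n) => Equiv.sumCongr p.1 p.2) := by
    have := Equiv.Perm.mem_sumCongrHom_range_of_perm_mapsTo_inl
      (σ := finSumFinEquiv.symm.permCongr π) (by
        rintro _ ⟨i, rfl⟩
        rcases hx : finSumFinEquiv.symm.permCongr π (Sum.inl i) with j | j
        · exact ⟨j, rfl⟩
        · exfalso
          have hx' : π (Fin.castAdd n i) = Fin.natAdd m j := by
            have := congrArg finSumFinEquiv hx
            simpa [Equiv.permCongr_apply] using this
          have := congrFun hπ (Fin.castAdd n i)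
          rw [Function.comp_apply, hx'] at this
          exact h.cross i j this.symm)
    obtain ⟨p, hp⟩ := this
    exact ⟨p, hp⟩
  obtain ⟨⟨σ, τ⟩, hp⟩ := key
  refine ⟨σ, τ, ?_⟩
  rw [permProd, show Equiv.sumCongr σ τ = finSumFinEquiv.symm.permCongr π from hp]
  ext i
  simp [Equiv.permCongr_apply]

lemma IsConcat.stabCard_eq {m n : ℕ} {b : Fin m → ℕ} {b' : Fin n → ℕ} {b'' : Fin (m + n) → ℕ}
    (h : IsConcat b b' b'') : stabCard b'' = stabCard b * stabCard b' := by
  simp only [stabCard]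
  rw [← Finset.card_product]
  symm
  refine Finset.card_bij (fun p _ => permProd p.1 p.2) ?_ ?_ ?_
  · intro p hp
    simp only [Finset.mem_product, Finset.mem_filter, Finset.mem_univ, true_and] at hp ⊢
    exact (h.comp_permProd _ _).2 hp
  · intro p _ q _ hpq
    exact Prod.ext (permProd_injective hpq).1 (permProd_injective hpq).2
  · intro π hπ
    simp only [Finset.mem_filter, Finset.mem_univ, true_and] at hπ
    obtain ⟨σ, τ, rfl⟩ := h.exists_permProd hπ
    refine ⟨(σ, τ), ?_, rfl⟩
    simp only [Finset.mem_product, Finset.mem_filter, Finset.mem_univ, true_and]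
    exact (h.comp_permProd _ _).1 hπ

/-! ### Characters induced from Young subgroups -/

section Induction

variable {H K : Type*} [Group H] [Group K]

open Classical in
lemma induce_eq_sum [Fintype H] [Fintype K] (φ : H →* K) (f : H → ℂ) (g : K) :
    induce φ f g =
      (Nat.card H : ℂ)⁻¹ * ∑ k : K, ∑ h : H, if φ h = k⁻¹ * g * k then f h else 0 := by
  simp only [induce, finsum_eq_sum_of_fintype]

-- The substitutions `k ↦ k φ(x)` and `h ↦ x⁻¹ h x` make every `x` contribute equally, which cancels
-- the factor `1/|H|`. This lets `f` be any function on `H`, not only a class function.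
open Classical in
lemma induce_sum_conj [Fintype H] [Fintype K] (φ : H →* K) (f : H → ℂ) (g : K) :
    induce φ (fun h => ∑ x : H, f (x⁻¹ * h * x)) g =
      ∑ k : K, ∑ h : H, if φ h = k⁻¹ * g * k then f h else 0 := by
  rw [induce_eq_sum]
  have key : ∀ x : H, (∑ k : K, ∑ h : H, if φ h = k⁻¹ * g * k then f (x⁻¹ * h * x) else 0) =
      ∑ k : K, ∑ h : H, if φ h = k⁻¹ * g * k then f h else 0 := by
    intro x
    rw [← Equiv.sum_comp (Equiv.mulRight (φ x))
      (fun k : K => ∑ h : H, if φ h = k⁻¹ * g * k then f h else 0)]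
    refine Finset.sum_congr rfl fun k _ => ?_
    rw [← Equiv.sum_comp (MulAut.conj x).symm.toEquiv
      (fun h : H => if φ h = (Equiv.mulRight (φ x) k)⁻¹ * g * Equiv.mulRight (φ x) k
        then f h else 0)]
    refine Finset.sum_congr rfl fun h _ => ?_
    have : φ ((MulAut.conj x).symm.toEquiv h) =
        (Equiv.mulRight (φ x) k)⁻¹ * g * Equiv.mulRight (φ x) k ↔ φ h = k⁻¹ * g * k := by
      simp only [MulEquiv.toEquiv_eq_coe, MulEquiv.coe_toEquiv, MulAut.conj_symm_apply, map_mul,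
        map_inv, Equiv.coe_mulRight, mul_inv_rev]
      constructor
      · intro hh
        calc φ h = φ x * ((φ x)⁻¹ * φ h * φ x) * (φ x)⁻¹ := by group
          _ = _ := by rw [hh]; group
      · intro hh; rw [hh]; group
    simp only [this]
    simp
  have : (∑ k : K, ∑ h : H, if φ h = k⁻¹ * g * k then ∑ x : H, f (x⁻¹ * h * x) else 0) =
      ∑ x : H, ∑ k : K, ∑ h : H, if φ h = k⁻¹ * g * k then f (x⁻¹ * h * x) else 0 := by
    symm
    rw [Finset.sum_comm]
    refine Finset.sum_congr rfl fun k _ => ?_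
    rw [Finset.sum_comm]
    refine Finset.sum_congr rfl fun h _ => ?_
    split_ifs <;> simp
  rw [this, Finset.sum_congr rfl fun x _ => key x, Finset.sum_const, nsmul_eq_mul, ← mul_assoc,
    Finset.card_univ, Nat.card_eq_fintype_card, inv_mul_cancel₀ (by
      exact_mod_cast Fintype.card_ne_zero), one_mul]

lemma induce_sum_conj_eq [Fintype H] [Fintype K] {φ : H →* K} (hφ : Function.Injective φ)
    {f : H → ℂ} {F : K → ℂ} (hF : ∀ h, f h = F (φ h)) (hF' : ∀ v, v ∉ Set.range φ → F v = 0)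
    (g : K) : induce φ (fun h => ∑ x : H, f (x⁻¹ * h * x)) g = ∑ k : K, F (k⁻¹ * g * k) := by
  classical
  rw [induce_sum_conj]
  refine Finset.sum_congr rfl fun k _ => ?_
  by_cases hv : k⁻¹ * g * k ∈ Set.range φ
  · obtain ⟨p, hp⟩ := hv
    rw [Finset.sum_eq_single p (fun q _ hq => if_neg fun h => hq (hφ (h.trans hp.symm)))
      (fun h => absurd (Finset.mem_univ p) h), if_pos hp, hF, hp]
  · rw [Finset.sum_eq_zero fun p _ => if_neg fun hp => hv ⟨p, hp⟩, hF' _ hv]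

lemma induce_smul [Finite H] [Finite K] (φ : H →* K) (c : ℂ) (f : H → ℂ) (g : K) :
    induce φ (fun h => c * f h) g = c * induce φ f g := by
  classical
  have := Fintype.ofFinite H
  have := Fintype.ofFinite K
  rw [induce_eq_sum, induce_eq_sum, mul_left_comm]
  congr 1
  simp only [Finset.mul_sum, mul_ite, mul_zero]

end Induction

/-! ### Monomial characters of wreath products -/

section WreathCharacters

variable {G : Type*} [CommGroup G] {n : ℕ}

lemma wreath_mul_left (w v : Wreath G n) (j : Fin n) :
    (w * v).left j = w.left j * v.left (w.right⁻¹ j) := rfl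

lemma wreath_inv_left (w : Wreath G n) (j : Fin n) :
    (w⁻¹).left j = (w.left (w.right j))⁻¹ := by
  rw [SemidirectProduct.inv_left]
  change (w.left (w.right⁻¹⁻¹ j))⁻¹ = _
  rw [inv_inv]

/-- The product of the `χ_{κ(j)}(g_j)` at the elements `(g, σ)` for which `κ` is constant on the
cycles of `σ`, extended by zero to the wreath product. -/
def wordWeight (χ : ℕ → G →* ℂˣ) (κ : Fin n → ℕ) : FunComp G n :=
  fun w => if κ ∘ w.right = κ then ∏ j, (χ (κ j) (w.left j) : ℂ) else 0

/-- The character of `G ≀ 𝔖ₙ` induced from the linear character of the Young subgroup of the word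
`b` that is given by `χᵢ` on the block of the letter `i`. -/
def youngInd (χ : ℕ → G →* ℂˣ) (b : Fin n → ℕ) : FunComp G n :=
  fun w => ∑ κ ∈ arrangements b, wordWeight χ κ w

lemma wordWeight_conj (χ : ℕ → G →* ℂˣ) (κ : Fin n → ℕ) (k w : Wreath G n) :
    wordWeight χ κ (k⁻¹ * w * k) = wordWeight χ (κ ∘ ⇑k.right⁻¹) w := by
  have hiff : κ ∘ (k⁻¹ * w * k).right = κ ↔ (κ ∘ ⇑k.right⁻¹) ∘ w.right = κ ∘ ⇑k.right⁻¹ := by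
    simp only [SemidirectProduct.mul_right, SemidirectProduct.inv_right, funext_iff,
      Function.comp_apply, Equiv.Perm.mul_apply]
    refine ⟨fun h i => ?_, fun h i => ?_⟩
    · simpa using h (k.right⁻¹ i)
    · simpa using h (k.right i)
  unfold wordWeight
  by_cases hw : (κ ∘ ⇑k.right⁻¹) ∘ w.right = κ ∘ ⇑k.right⁻¹
  · rw [if_pos (hiff.2 hw), if_pos hw]
    have hκ : ∀ j, κ (k.right⁻¹ (w.right j)) = κ (k.right⁻¹ j) := fun j => congrFun hw j
    simp only [wreath_mul_left, wreath_inv_left, SemidirectProduct.mul_right,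
      SemidirectProduct.inv_right, map_mul, map_inv, Units.val_mul, Finset.prod_mul_distrib,
      inv_inv, mul_inv_rev, Equiv.Perm.mul_apply, Function.comp_apply]
    -- After reindexing, the factors coming from `k` and from `k⁻¹` run over the same positions,
    -- because the word is constant on the cycles of `w`; they cancel.
    rw [← Equiv.prod_comp k.right⁻¹
        (fun j => (((χ (κ j)) (k.left (k.right j)))⁻¹ : ℂˣ).1),
      ← Equiv.prod_comp k.right⁻¹ (fun j => ((χ (κ j)) (w.left (k.right j))).1),
      ← Equiv.prod_comp (k.right⁻¹ * w.right)
        (fun j => ((χ (κ j)) (k.left (w.right⁻¹ (k.right j)))).1)]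
    simp only [Equiv.Perm.mul_apply, perm_apply_inv_self, perm_inv_apply_self, hκ]
    rw [mul_right_comm, ← Finset.prod_mul_distrib]
    simp
  · rw [if_neg (mt hiff.1 hw), if_neg hw]

/-- Conjugation by `k` only permutes the word, so the base group contributes the factor `|G|^n` and
the permutations contribute `stabCard b` times the sum over rearrangements. Up to this constant,
`youngInd` is thus the sum of the conjugates of one function supported on a Young subgroup. -/
lemma sum_wordWeight_conj [Finite G] [Fintype (Wreath G n)] (χ : ℕ → G →* ℂˣ) (b : Fin n → ℕ)
    (w : Wreath G n) : ∑ k : Wreath G n, wordWeight χ b (k⁻¹ * w * k) =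
      ((Nat.card G) ^ n * stabCard b : ℕ) * youngInd χ b w := by
  have := Fintype.ofFinite G
  simp only [wordWeight_conj]
  rw [← Equiv.sum_comp
    (SemidirectProduct.equivProd.symm : (Fin n → G) × Equiv.Perm (Fin n) ≃ Wreath G n)
    (fun k : Wreath G n => wordWeight χ (b ∘ ⇑k.right⁻¹) w), Fintype.sum_prod_type]
  change ∑ _ : Fin n → G, ∑ π : Equiv.Perm (Fin n), wordWeight χ (b ∘ ⇑π⁻¹) w = _
  rw [Finset.sum_const, show ∑ π : Equiv.Perm (Fin n), wordWeight χ (b ∘ ⇑π⁻¹) w =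
      ∑ π : Equiv.Perm (Fin n), wordWeight χ (b ∘ ⇑π) w from
    Equiv.sum_comp (Equiv.inv (Equiv.Perm (Fin n))) (fun π => wordWeight χ (b ∘ ⇑π) w),
    sum_comp_perm b (fun κ => wordWeight χ κ w)]
  simp [youngInd, mul_assoc]

lemma wordWeight_congr {χ χ' : ℕ → G →* ℂˣ} {b b' : Fin n → ℕ}
    (h : ∀ i j, b i = b j ↔ b' i = b' j) (hχ : χ ∘ b = χ' ∘ b') :
    wordWeight χ b = wordWeight χ' b' := by
  funext w
  have : b ∘ w.right = b ↔ b' ∘ w.right = b' := by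
    simp only [funext_iff, Function.comp_apply, h]
  simp only [wordWeight, this]
  congr 1
  exact Finset.prod_congr rfl fun j _ => by rw [show χ (b j) = χ' (b' j) from congrFun hχ j]

/-- The two sets of rearrangements may differ, so the sums are not compared term by term:
`wordWeight` is the same for both words, and the nonzero constant of `sum_wordWeight_conj` is
cancelled. -/
lemma youngInd_congr [Finite G] {χ χ' : ℕ → G →* ℂˣ} {b b' : Fin n → ℕ}
    (h : ∀ i j, b i = b j ↔ b' i = b' j) (hχ : χ ∘ b = χ' ∘ b') :
    youngInd χ b = youngInd χ' b' := by
  have := Fintype.ofFinite (Wreath G n)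
  funext w
  have h1 := sum_wordWeight_conj χ b w
  rw [wordWeight_congr h hχ, sum_wordWeight_conj, stabCard_congr h] at h1
  refine (mul_left_cancel₀ ?_ h1).symm
  exact_mod_cast (Nat.mul_pos (pow_pos Nat.card_pos n) (stabCard_pos b')).ne'

lemma youngInd_const (χ : ℕ → G →* ℂˣ) (i : ℕ) :
    youngInd χ (fun _ : Fin n => i) = eta n (χ i) := by
  have : arrangements (fun _ : Fin n => i) = {fun _ => i} := by
    ext κ; rw [mem_arrangements, Finset.mem_singleton]
    exact ⟨fun ⟨_, h⟩ => h.symm, fun h => ⟨1, h.symm⟩⟩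
  funext w
  simp only [youngInd, this, Finset.sum_singleton, wordWeight, eta]
  rw [if_pos (show (fun _ => i) ∘ ⇑w.right = fun _ => i from rfl), map_prod]
  simp

lemma young_injective (m n : ℕ) : Function.Injective (young G m n) := by
  rintro ⟨p, q⟩ ⟨p', q'⟩ h
  have hl : Fin.append p.left q.left = Fin.append p'.left q'.left :=
    congrArg SemidirectProduct.left h
  have hr : permProd p.right q.right = permProd p'.right q'.right :=
    congrArg SemidirectProduct.right h
  refine Prod.ext (SemidirectProduct.ext ?_ (permProd_injective hr).1)
    (SemidirectProduct.ext ?_ (permProd_injective hr).2)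
  · funext i; simpa using congrFun hl (Fin.castAdd n i)
  · funext i; simpa using congrFun hl (Fin.natAdd m i)

lemma IsConcat.wordWeight_young {m n : ℕ} {χ χ' χ'' : ℕ → G →* ℂˣ} {b : Fin m → ℕ}
    {b' : Fin n → ℕ} {b'' : Fin (m + n) → ℕ} (h : IsConcat b b' b'')
    (hl : ∀ i, χ'' (b'' (Fin.castAdd n i)) = χ (b i))
    (hr : ∀ i, χ'' (b'' (Fin.natAdd m i)) = χ' (b' i)) (p : Wreath G m × Wreath G n) :
    wordWeight χ b p.1 * wordWeight χ' b' p.2 = wordWeight χ'' b'' (young G m n p) := by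
  obtain ⟨p, q⟩ := p
  have hc : b'' ∘ (young G m n (p, q)).right = b'' ↔ b ∘ p.right = b ∧ b' ∘ q.right = b' :=
    h.comp_permProd _ _
  have hl' : (young G m n (p, q)).left = Fin.append p.left q.left := rfl
  simp only [wordWeight, hc, hl', Fin.prod_univ_add, Fin.append_left, Fin.append_right, hl, hr]
  by_cases h1 : b ∘ p.right = b <;> by_cases h2 : b' ∘ q.right = b' <;> simp [h1, h2]

lemma IsConcat.wordWeight_eq_zero {m n : ℕ} {χ'' : ℕ → G →* ℂˣ} {b : Fin m → ℕ}
    {b' : Fin n → ℕ} {b'' : Fin (m + n) → ℕ} (h : IsConcat b b' b'') (v : Wreath G (m + n))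
    (hv : v ∉ Set.range (young G m n)) : wordWeight χ'' b'' v = 0 := by
  rw [wordWeight, if_neg]
  intro hb
  obtain ⟨σ, τ, hστ⟩ := h.exists_permProd hb
  refine hv ⟨(⟨fun i => v.left (Fin.castAdd n i), σ⟩, ⟨fun i => v.left (Fin.natAdd m i), τ⟩),
    SemidirectProduct.ext ?_ hστ⟩
  funext i
  change Fin.append _ _ i = _
  refine Fin.addCases (fun i => ?_) (fun i => ?_) i <;> simp

/-- Transitivity of induction. Both factors are normalized sums of conjugates of word weights; the
product of these weights, extended by zero along the Young embedding, is the weight of the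
concatenation, and the normalizing constants multiply. -/
lemma IsConcat.indMul_youngInd [Finite G] {m n : ℕ} {χ χ' χ'' : ℕ → G →* ℂˣ} {b : Fin m → ℕ}
    {b' : Fin n → ℕ} {b'' : Fin (m + n) → ℕ} (h : IsConcat b b' b'')
    (hl : ∀ i, χ'' (b'' (Fin.castAdd n i)) = χ (b i))
    (hr : ∀ i, χ'' (b'' (Fin.natAdd m i)) = χ' (b' i)) :
    indMul G (youngInd χ b) (youngInd χ' b') = youngInd χ'' b'' := by
  classical
  have := Fintype.ofFinite (Wreath G m)
  have := Fintype.ofFinite (Wreath G n)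
  have := Fintype.ofFinite (Wreath G (m + n))
  funext w
  set C : ℂ := ((Nat.card G ^ m * stabCard b : ℕ) : ℂ) with hC
  set C' : ℂ := ((Nat.card G ^ n * stabCard b' : ℕ) : ℂ) with hC'
  have hC0 : C ≠ 0 := by
    rw [hC]
    exact_mod_cast (Nat.mul_pos (pow_pos Nat.card_pos m) (stabCard_pos b)).ne'
  have hC0' : C' ≠ 0 := by
    rw [hC']
    exact_mod_cast (Nat.mul_pos (pow_pos Nat.card_pos n) (stabCard_pos b')).ne'
  have hC'' : ((Nat.card G ^ (m + n) * stabCard b'' : ℕ) : ℂ) = C * C' := by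
    rw [hC, hC', h.stabCard_eq]; push_cast; ring
  have h1 : (fun p : Wreath G m × Wreath G n => youngInd χ b p.1 * youngInd χ' b' p.2) =
      fun p => (C * C')⁻¹ * ∑ x : Wreath G m × Wreath G n,
        (fun q : Wreath G m × Wreath G n => wordWeight χ b q.1 * wordWeight χ' b' q.2)
          (x⁻¹ * p * x) := by
    funext p
    have e1 := sum_wordWeight_conj χ b p.1
    have e2 := sum_wordWeight_conj χ' b' p.2
    rw [Fintype.sum_prod_type]
    simp only [Prod.fst_mul, Prod.snd_mul, Prod.fst_inv, Prod.snd_inv]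
    rw [← Finset.sum_mul_sum, e1, e2, ← hC, ← hC']
    field_simp
  rw [indMul, h1, induce_smul, induce_sum_conj_eq (young_injective m n)
    (f := fun q : Wreath G m × Wreath G n => wordWeight χ b q.1 * wordWeight χ' b' q.2)
    (h.wordWeight_young hl hr) h.wordWeight_eq_zero]
  rw [sum_wordWeight_conj, hC'', ← mul_assoc, inv_mul_cancel₀ (mul_ne_zero hC0 hC0'), one_mul]

/-- The monomial representation of `G ≀ 𝔖ₙ` on the functions on the rearrangements of `b`. -/
def youngRep (χ : ℕ → G →* ℂˣ) (b : Fin n → ℕ) :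
    Representation ℂ (Wreath G n) ({κ // κ ∈ arrangements b} → ℂ) where
  toFun w :=
    { toFun := fun f κ => (∏ j, (χ (κ.1 j) (w.left j) : ℂ)) *
        f ⟨κ.1 ∘ w.right, comp_perm_mem_arrangements κ.2 _⟩
      map_add' := fun f f' => by funext κ; simp [mul_add]
      map_smul' := fun c f => by funext κ; simp [mul_left_comm] }
  map_one' := by
    ext f κ
    simp
  map_mul' w v := by
    refine LinearMap.ext fun f => funext fun κ => ?_
    simp only [LinearMap.coe_mk, AddHom.coe_mk, Module.End.mul_apply, wreath_mul_left, map_mul,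
      Units.val_mul, Finset.prod_mul_distrib, Function.comp_apply]
    rw [← Equiv.prod_comp w.right (fun j => ((χ (κ.1 j)) (v.left (w.right⁻¹ j))).1), mul_assoc]
    simp only [perm_inv_apply_self]
    rfl

/-- The matrices are monomial, and a diagonal entry is nonzero exactly at the words fixed by the
permutation. -/
lemma youngRep_character (χ : ℕ → G →* ℂˣ) (b : Fin n → ℕ) :
    (youngRep χ b).character = youngInd χ b := by
  classical
  funext w
  rw [Representation.character,
    LinearMap.trace_eq_matrix_trace ℂ (Pi.basisFun ℂ {κ // κ ∈ arrangements b}), Matrix.trace]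
  change _ = ∑ κ ∈ arrangements b, wordWeight χ κ w
  rw [← Finset.sum_coe_sort (arrangements b) (fun κ => wordWeight χ κ w)]
  refine Finset.sum_congr rfl fun κ _ => ?_
  rw [Matrix.diag_apply, LinearMap.toMatrix_apply, Pi.basisFun_repr]
  simp only [Pi.basisFun_apply, youngRep, MonoidHom.coe_mk, OneHom.coe_mk, LinearMap.coe_mk,
    AddHom.coe_mk, Pi.single_apply, wordWeight, Subtype.ext_iff]
  split_ifs <;> simp

lemma youngInd_mem_virtualChars (χ : ℕ → G →* ℂˣ) (b : Fin n → ℕ) :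
    youngInd χ b ∈ virtualChars (Wreath G n) := by
  refine Submodule.subset_span ⟨Fintype.card {κ // κ ∈ arrangements b},
    { toFun := fun w => (LinearEquiv.funCongrLeft ℂ ℂ
          (Fintype.equivFin {κ // κ ∈ arrangements b}).symm).conj (youngRep χ b w)
      map_one' := by rw [map_one]; exact LinearEquiv.conj_id _
      map_mul' := fun w v => by rw [map_mul]; exact LinearEquiv.conj_comp _ _ _ }, ?_⟩
  rw [← youngRep_character]
  funext w
  exact (LinearMap.trace_conj' (youngRep χ b w) (LinearEquiv.funCongrLeft ℂ ℂ
    (Fintype.equivFin {κ // κ ∈ arrangements b}).symm)).symm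

end WreathCharacters

/-! ### Ranks -/

lemma exists_rank {n : ℕ} {α : Type*} [LinearOrder α] {k : Fin n → α} (hk : Function.Injective k) :
    ∃ r : Equiv.Perm (Fin n), ∀ p q, r p < r q ↔ k p < k q := by
  have hs : StrictMono (k ∘ Tuple.sort k) :=
    (Tuple.monotone_sort k).strictMono_of_injective (hk.comp (Tuple.sort k).injective)
  refine ⟨(Tuple.sort k)⁻¹, fun p q => ?_⟩
  rw [← hs.lt_iff_lt]
  simp

lemma perm_eq_one_of_strictMono {n : ℕ} {π : Equiv.Perm (Fin n)} (h : StrictMono π) : π = 1 := by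
  have := Tuple.unique_monotone (f := id) (σ := π) (τ := 1) h.monotone monotone_id
  ext i
  simpa using congrArg Fin.val (congrFun this i)

lemma perm_eq_of_lt_iff {n : ℕ} {π π' : Equiv.Perm (Fin n)} (h : ∀ p q, π p < π q → π' p < π' q) :
    π = π' := by
  have : π' * π⁻¹ = 1 := perm_eq_one_of_strictMono fun p q hpq => by
    simpa using h (π⁻¹ p) (π⁻¹ q) (by simpa using hpq)
  exact (mul_inv_eq_one.1 this).symm

/-! ### Products of the elements `y_{n,a}` -/

/-- The permutations that increase on the fibres of `b`. -/
def increasingOn {n : ℕ} (b : Fin n → ℕ) : Finset (Equiv.Perm (Fin n)) :=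
  Finset.univ.filter fun ρ => ∀ i j, b i = b j → i < j → ρ i < ρ j

lemma mem_increasingOn {n : ℕ} {b : Fin n → ℕ} {ρ : Equiv.Perm (Fin n)} :
    ρ ∈ increasingOn b ↔ ∀ i j, b i = b j → i < j → ρ i < ρ j := by
  simp [increasingOn]

section External

variable {A : Type*} [Group A] {m n : ℕ}

/-- The element `σ · (a₁, …, aₙ)` of `A ≀ 𝔖ₙ`. -/
def permWord (σ : Equiv.Perm (Fin n)) (a : Fin n → A) : Wreath A n :=
  SemidirectProduct.inr σ * SemidirectProduct.inl a

lemma permWord_right (σ : Equiv.Perm (Fin n)) (a : Fin n → A) : (permWord σ a).right = σ := by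
  simp [permWord]

lemma permWord_left (σ : Equiv.Perm (Fin n)) (a : Fin n → A) (i : Fin n) :
    (permWord σ a).left i = a (σ⁻¹ i) := by
  have : (permWord σ a).left i = 1 * a (σ⁻¹ i) := rfl
  rw [this, one_mul]

lemma permWord_inj {σ σ' : Equiv.Perm (Fin n)} {a a' : Fin n → A} :
    permWord σ a = permWord σ' a' ↔ σ = σ' ∧ a = a' := by
  constructor
  · intro h
    have h1 : σ = σ' := by rw [← permWord_right σ a, h, permWord_right]
    subst h1
    refine ⟨rfl, ?_⟩
    simpa [permWord] using h
  · rintro ⟨rfl, rfl⟩; rfl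

lemma young_permWord (σ : Equiv.Perm (Fin m)) (τ : Equiv.Perm (Fin n)) (a : Fin m → A)
    (a' : Fin n → A) : young A m n (permWord σ a, permWord τ a') =
      permWord (permProd σ τ) (Fin.append a a') := by
  refine SemidirectProduct.ext ?_ ?_
  · funext i
    rw [permWord_left, permProd_inv]
    change Fin.append _ _ i = _
    refine Fin.addCases (fun i => ?_) (fun i => ?_) i <;> simp [permWord_left]
  · rw [permWord_right]
    change permProd _ _ = _
    rw [permWord_right, permWord_right]

lemma inr_mul_permWord (ρ σ : Equiv.Perm (Fin n)) (a : Fin n → A) :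
    SemidirectProduct.inr ρ * permWord σ a = permWord (ρ * σ) a := by
  rw [permWord, permWord, map_mul, mul_assoc]

/-- The sum of the `ρ · (a₁, …, aₙ)` over the permutations `ρ` that increase on the fibres of `b`.
If the fibres of `b` are intervals on which `a` is constant, this is a product of elements
`y_{k,c}`. -/
def shuffleProd (b : Fin n → ℕ) (a : Fin n → A) : FComp A n :=
  ∑ ρ ∈ increasingOn b, MonoidAlgebra.single (permWord ρ a) 1

open Classical in
lemma extMul_single (u : Wreath A m) (v : Wreath A n) :
    extMul A (MonoidAlgebra.single u 1) (MonoidAlgebra.single v 1) =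
      ∑ ρ ∈ Finset.univ.filter (· ∈ shuffles m n),
        MonoidAlgebra.single (SemidirectProduct.inr ρ * young A m n (u, v)) 1 := by
  have : young A m n (u, 1) * young A m n (1, v) = young A m n (u, v) := by
    rw [← map_mul, Prod.mk_mul_mk, mul_one, one_mul]
  rw [extMul, shuffleSum, ← Finset.sum_filter]
  simp only [MonoidAlgebra.mapDomainRingHom_apply, MonoidAlgebra.mapDomain_single,
    MonoidHom.comp_apply, MonoidHom.inl_apply, MonoidHom.inr_apply,
    MonoidAlgebra.single_mul_single, Finset.sum_mul, this, mul_one]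

lemma extMul_sum {ι κ : Type*} (s : Finset ι) (t : Finset κ) (f : ι → FComp A m)
    (g : κ → FComp A n) :
    extMul A (∑ i ∈ s, f i) (∑ j ∈ t, g j) = ∑ i ∈ s, ∑ j ∈ t, extMul A (f i) (g j) := by
  simp only [extMul, map_sum, Finset.sum_mul, Finset.mul_sum]
  exact Finset.sum_comm

lemma mem_shuffles_mul_permProd {b : Fin m → ℕ} {b' : Fin n → ℕ}
    {b'' : Fin (m + n) → ℕ} (h : IsConcat b b' b'') {ρ : Equiv.Perm (Fin (m + n))}
    (hρ : ρ ∈ shuffles m n) (σ : Equiv.Perm (Fin m)) (τ : Equiv.Perm (Fin n)) :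
    ρ * permProd σ τ ∈ increasingOn b'' ↔ σ ∈ increasingOn b ∧ τ ∈ increasingOn b' := by
  simp only [mem_increasingOn, Equiv.Perm.mul_apply]
  constructor
  · intro H
    refine ⟨fun i j hb hij => ?_, fun i j hb hij => ?_⟩
    · have := H (Fin.castAdd n i) (Fin.castAdd n j) ((h.left i j).2 hb) hij
      rw [permProd_castAdd, permProd_castAdd] at this
      exact hρ.1.lt_iff_lt.1 this
    · have := H (Fin.natAdd m i) (Fin.natAdd m j) ((h.right i j).2 hb) (by simpa using hij)
      rw [permProd_natAdd, permProd_natAdd] at this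
      exact hρ.2.lt_iff_lt.1 this
  · rintro ⟨H, H'⟩ i j
    refine Fin.addCases (fun i => ?_) (fun i => ?_) i <;>
      refine Fin.addCases (fun j => ?_) (fun j => ?_) j
    · intro hb hij
      rw [permProd_castAdd, permProd_castAdd]
      exact hρ.1 (H i j ((h.left i j).1 hb) hij)
    · intro hb; exact absurd hb (h.cross i j)
    · intro hb; exact absurd hb.symm (h.cross j i)
    · intro hb hij
      rw [permProd_natAdd, permProd_natAdd]
      exact hρ.2 (H' i j ((h.right i j).1 hb) (by simpa using hij))

/-- Shuffles represent the left cosets of the Young subgroup: `σ` and `τ` record the relative order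
of the values of `π` on the two halves, and dividing by `permProd σ τ` leaves both halves
increasing. -/
lemma exists_shuffle_mul_permProd (π : Equiv.Perm (Fin (m + n))) :
    ∃ ρ ∈ shuffles m n, ∃ σ τ, ρ * permProd σ τ = π := by
  obtain ⟨σ, hσ⟩ := exists_rank (k := fun i : Fin m => π (Fin.castAdd n i))
    (π.injective.comp (Fin.castAdd_injective m n))
  obtain ⟨τ, hτ⟩ := exists_rank (k := fun i : Fin n => π (Fin.natAdd m i))
    (π.injective.comp (Fin.natAdd_injective n m))
  refine ⟨π * (permProd σ τ)⁻¹, ⟨fun i j hij => ?_, fun i j hij => ?_⟩, σ, τ, by simp⟩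
  · simpa [permProd_inv] using (hσ (σ⁻¹ i) (σ⁻¹ j)).1 (by simpa using hij)
  · simpa [permProd_inv] using (hτ (τ⁻¹ i) (τ⁻¹ j)).1 (by simpa using hij)

lemma shuffle_mul_permProd_inj {ρ ρ' : Equiv.Perm (Fin (m + n))} (hρ : ρ ∈ shuffles m n)
    (hρ' : ρ' ∈ shuffles m n) {σ σ' : Equiv.Perm (Fin m)} {τ τ' : Equiv.Perm (Fin n)}
    (h : ρ * permProd σ τ = ρ' * permProd σ' τ') : ρ = ρ' ∧ σ = σ' ∧ τ = τ' := by
  have h1 : σ = σ' := perm_eq_of_lt_iff fun p q hpq => by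
    have hp := congrArg (fun π => π (Fin.castAdd n p)) h
    have hq := congrArg (fun π => π (Fin.castAdd n q)) h
    simp only [Equiv.Perm.mul_apply, permProd_castAdd] at hp hq
    have := hρ.1 hpq
    simp only [hp, hq] at this
    exact hρ'.1.lt_iff_lt.1 this
  have h2 : τ = τ' := perm_eq_of_lt_iff fun p q hpq => by
    have hp := congrArg (fun π => π (Fin.natAdd m p)) h
    have hq := congrArg (fun π => π (Fin.natAdd m q)) h
    simp only [Equiv.Perm.mul_apply, permProd_natAdd] at hp hq
    have := hρ.2 hpq
    simp only [hp, hq] at this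
    exact hρ'.2.lt_iff_lt.1 this
  subst h1 h2
  exact ⟨mul_right_cancel h, rfl, rfl⟩

/-- By the unique factorization `π = ρ (σ × τ)` with `ρ` a shuffle, `π` increases on the fibres of
`b''` exactly when `σ` and `τ` increase on those of `b` and `b'`. -/
lemma IsConcat.extMul_shuffleProd {b : Fin m → ℕ} {b' : Fin n → ℕ} {b'' : Fin (m + n) → ℕ}
    (h : IsConcat b b' b'') (a : Fin m → A) (a' : Fin n → A) :
    extMul A (shuffleProd b a) (shuffleProd b' a') = shuffleProd b'' (Fin.append a a') := by
  classical
  rw [shuffleProd, shuffleProd, extMul_sum]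
  simp only [extMul_single, young_permWord, inr_mul_permWord]
  rw [← Finset.sum_product', ← Finset.sum_product']
  refine Finset.sum_bij (fun p _ => p.2 * permProd p.1.1 p.1.2) ?_ ?_ ?_ ?_
  · rintro ⟨⟨σ, τ⟩, ρ⟩ hp
    simp only [Finset.mem_product, Finset.mem_filter, Finset.mem_univ, true_and] at hp
    exact (mem_shuffles_mul_permProd h hp.2 σ τ).2 hp.1
  · rintro ⟨⟨σ, τ⟩, ρ⟩ hp ⟨⟨σ', τ'⟩, ρ'⟩ hp' he
    simp only [Finset.mem_product, Finset.mem_filter, Finset.mem_univ, true_and] at hp hp'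
    obtain ⟨rfl, rfl, rfl⟩ := shuffle_mul_permProd_inj hp.2 hp'.2 he
    rfl
  · intro π hπ
    obtain ⟨ρ, hρ, σ, τ, rfl⟩ := exists_shuffle_mul_permProd π
    refine ⟨((σ, τ), ρ), ?_, rfl⟩
    simp only [Finset.mem_product, Finset.mem_filter, Finset.mem_univ, true_and]
    exact ⟨(mem_shuffles_mul_permProd h hρ σ τ).1 hπ, hρ⟩
  · intros; rfl

lemma shuffleProd_const (i : ℕ) (a : A) :
    shuffleProd (fun _ : Fin n => i) (fun _ => a) = yGen n (MonoidAlgebra.single a 1) := by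
  have : increasingOn (fun _ : Fin n => i) = {1} := by
    ext ρ
    rw [mem_increasingOn, Finset.mem_singleton]
    refine ⟨fun h => perm_eq_one_of_strictMono fun p q hpq => h p q rfl hpq, ?_⟩
    rintro rfl p q _ hpq
    exact hpq
  rw [shuffleProd, this, Finset.sum_singleton, yGen, MonoidAlgebra.mapDomain_single]
  congr 1
  refine SemidirectProduct.ext (funext fun i => ?_) (permWord_right _ _)
  rw [permWord_left]

lemma yGen_zero (a : A) : yGen 0 (MonoidAlgebra.single a 1) = 1 := by
  rw [yGen, MonoidAlgebra.mapDomain_single, MonoidAlgebra.one_def]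
  congr 1
  exact SemidirectProduct.ext (Subsingleton.elim _ _) rfl

lemma coeff_shuffleProd (b : Fin n → ℕ) (a a' : Fin n → A) (π : Equiv.Perm (Fin n))
    [Decidable (a = a' ∧ π ∈ increasingOn b)] :
    (shuffleProd b a).coeff (permWord π a') = if a = a' ∧ π ∈ increasingOn b then 1 else 0 := by
  classical
  rw [shuffleProd, MonoidAlgebra.coeff_sum, Finsupp.finsetSum_apply]
  simp only [MonoidAlgebra.coeff_single, Finsupp.single_apply, permWord_inj]
  by_cases ha : a = a'
  · simp [ha]
  · simp [ha]

end External

/-! ### A basis -/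

section Basis

/-- Words in `A` with a partition of the letters into intervals on which the word is constant. -/
structure BlockWord (A : Type*) where
  /-- The number of letters. -/
  len : ℕ
  /-- The letters. -/
  word : Fin len → A
  /-- The partition into blocks. -/
  blocks : Setoid (Fin len)
  exists_block : ∃ b : Fin len → ℕ, Monotone b ∧ Setoid.ker b = blocks ∧ ∃ χ : ℕ → A, χ ∘ b = word

variable {A : Type*}

namespace BlockWord

/-- The block to which a letter belongs. -/
def block (d : BlockWord A) : Fin d.len → ℕ := d.exists_block.choose

/-- The letter that a block consists of. -/
def letter (d : BlockWord A) : ℕ → A := d.exists_block.choose_spec.2.2.choose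

lemma monotone_block (d : BlockWord A) : Monotone d.block := d.exists_block.choose_spec.1

lemma ker_block (d : BlockWord A) : Setoid.ker d.block = d.blocks := d.exists_block.choose_spec.2.1

lemma letter_comp_block (d : BlockWord A) : d.letter ∘ d.block = d.word :=
  d.exists_block.choose_spec.2.2.choose_spec

/-- The partition into the fibres of a monotone function. -/
def ofBlock {n : ℕ} (b : Fin n → ℕ) (hb : Monotone b) (χ : ℕ → A) : BlockWord A :=
  ⟨n, χ ∘ b, Setoid.ker b, b, hb, rfl, χ, rfl⟩

lemma block_ofBlock {n : ℕ} (b : Fin n → ℕ) (hb : Monotone b) (χ : ℕ → A) (i j : Fin n) :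
    (ofBlock b hb χ).block i = (ofBlock b hb χ).block j ↔ b i = b j := by
  have h := (ofBlock b hb χ).ker_block
  have : Setoid.ker (ofBlock b hb χ).block i j ↔ Setoid.ker b i j := by rw [h]; rfl
  exact this

lemma letter_ofBlock {n : ℕ} (b : Fin n → ℕ) (hb : Monotone b) (χ : ℕ → A) :
    (ofBlock b hb χ).letter ∘ (ofBlock b hb χ).block = χ ∘ b :=
  (ofBlock b hb χ).letter_comp_block

lemma exists_isConcat {m n : ℕ} {b : Fin m → ℕ} {b' : Fin n → ℕ} (hb : Monotone b)
    (hb' : Monotone b') (χ χ' : ℕ → A) : ∃ (b'' : Fin (m + n) → ℕ) (χ'' : ℕ → A),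
      Monotone b'' ∧ IsConcat b b' b'' ∧ (∀ i, χ'' (b'' (Fin.castAdd n i)) = χ (b i)) ∧
        ∀ i, χ'' (b'' (Fin.natAdd m i)) = χ' (b' i) := by
  obtain ⟨N, hN⟩ : ∃ N, ∀ i, b i < N :=
    ⟨∑ i, b i + 1, fun i =>
      Nat.lt_succ_of_le (Finset.single_le_sum (fun _ _ => Nat.zero_le _) (Finset.mem_univ i))⟩
  -- Shifting by a strict upper bound `N` of `b` keeps the word monotone and the two sets of letters
  -- disjoint.
  refine ⟨Fin.append b (fun j => N + b' j), fun k => if k < N then χ k else χ' (k - N),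
    ?_, ⟨?_, ?_, ?_⟩, ?_, ?_⟩
  · intro i j
    refine Fin.addCases (fun i => ?_) (fun i => ?_) i <;>
      refine Fin.addCases (fun j => ?_) (fun j => ?_) j <;> intro hij
    · have hij' : i ≤ j := hij
      simpa using hb hij'
    · simpa using (hN i).le.trans (Nat.le_add_right _ _)
    · exfalso
      have h1 : m + (i : ℕ) ≤ j := by simpa [Fin.le_def] using hij
      have := j.2
      omega
    · simpa using hb' (by simpa using hij)
  · intro i j; simp
  · intro i j; simp
  · intro i j; simpa using ((hN i).trans_le (Nat.le_add_right _ _)).ne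
  · intro i; simp [hN i]
  · intro i; simp

lemma append_comp {m n : ℕ} {b : Fin m → ℕ} {b' : Fin n → ℕ} {b'' : Fin (m + n) → ℕ}
    {χ χ' χ'' : ℕ → A} (hl : ∀ i, χ'' (b'' (Fin.castAdd n i)) = χ (b i))
    (hr : ∀ i, χ'' (b'' (Fin.natAdd m i)) = χ' (b' i)) :
    Fin.append (χ ∘ b) (χ' ∘ b') = χ'' ∘ b'' := by
  funext i
  refine Fin.addCases (fun i => ?_) (fun i => ?_) i <;> simp [hl, hr]

variable [Group A]

/-- The product of elements `y_{k,a}` that belongs to a word with blocks. -/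
def toF (d : BlockWord A) : F A :=
  DirectSum.of (FComp A) d.len (shuffleProd d.block (d.letter ∘ d.block))

lemma shuffleProd_congr {n : ℕ} {b b' : Fin n → ℕ} (h : ∀ i j, b i = b j ↔ b' i = b' j)
    (a : Fin n → A) : shuffleProd b a = shuffleProd b' a := by
  simp only [shuffleProd, increasingOn, h]

lemma toF_ofBlock {n : ℕ} (b : Fin n → ℕ) (hb : Monotone b) (χ : ℕ → A) :
    (ofBlock b hb χ).toF = DirectSum.of (FComp A) n (shuffleProd b (χ ∘ b)) := by
  rw [toF, letter_ofBlock]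
  exact congrArg _ (shuffleProd_congr (block_ofBlock b hb χ) _)

/-- A permutation whose descents are the ends of the blocks. -/
lemma exists_perm_lt_iff {n : ℕ} {b : Fin n → ℕ} (hb : Monotone b) :
    ∃ ρ : Equiv.Perm (Fin n), ∀ i j, i < j → (ρ i < ρ j ↔ b i = b j) := by
  -- Later blocks receive the smaller values, while inside a block the order is kept.
  obtain ⟨ρ, hρ⟩ := exists_rank (k := fun i : Fin n => toLex (OrderDual.toDual (b i), i))
    (fun i j h => (Prod.ext_iff.1 (toLex.injective h)).2)
  refine ⟨ρ, fun i j hij => ?_⟩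
  rw [hρ, Prod.Lex.toLex_lt_toLex]
  simp only [OrderDual.toDual_lt_toDual, hij, and_true, OrderDual.toDual_inj]
  exact ⟨fun h => h.resolve_left (hb hij.le).not_gt, Or.inr⟩

/-- A nonzero coefficient forces equal words and `ρ` increasing on the blocks of `e`. By the choice
of `ρ`, the blocks of `e` then refine those of `d`, and counting equivalent pairs makes the
partitions equal. -/
lemma eq_of_coeff_toF_ne_zero {d e : BlockWord A} {ρ : Equiv.Perm (Fin d.len)}
    (hρ : ∀ i j, i < j → (ρ i < ρ j ↔ d.block i = d.block j))
    (h : (e.toF d.len).coeff (permWord ρ d.word) ≠ 0)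
    (hmin : (Finset.univ.filter fun p : Fin d.len × Fin d.len => d.block p.1 = d.block p.2).card ≤
      (Finset.univ.filter fun p : Fin e.len × Fin e.len => e.block p.1 = e.block p.2).card) :
    e = d := by
  classical
  by_cases hlen : e.len = d.len
  · obtain ⟨n, a, s, hs⟩ := e
    obtain ⟨n', a', s', hs'⟩ := d
    obtain rfl : n = n' := hlen
    let e : BlockWord A := ⟨n, a, s, hs⟩
    let d : BlockWord A := ⟨n, a', s', hs'⟩
    rw [toF] at h
    change ((DirectSum.of (FComp A) n (shuffleProd e.block (e.letter ∘ e.block))) n).coeff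
      (permWord ρ a') ≠ 0 at h
    rw [DirectSum.of_eq_same, coeff_shuffleProd] at h
    obtain ⟨ha, hρe⟩ := (ite_ne_right_iff.1 h).1
    obtain rfl : a = a' := e.letter_comp_block.symm.trans ha
    have key : ∀ i j, i < j → e.block i = e.block j → d.block i = d.block j :=
      fun i j hij h => (hρ i j hij).1 (mem_increasingOn.1 hρe i j h hij)
    have hsub : (Finset.univ.filter fun p : Fin n × Fin n => e.block p.1 = e.block p.2) ⊆
        Finset.univ.filter fun p : Fin n × Fin n => d.block p.1 = d.block p.2 := by
      rintro ⟨i, j⟩ hp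
      simp only [Finset.mem_filter, Finset.mem_univ, true_and] at hp ⊢
      rcases lt_trichotomy i j with hij | rfl | hij
      · exact key i j hij hp
      · rfl
      · exact (key j i hij hp.symm).symm
    have heq := Finset.eq_of_subset_of_card_le hsub hmin
    obtain rfl : s = s' := by
      have e1 : Setoid.ker e.block = s := e.ker_block
      have e2 : Setoid.ker d.block = s' := d.ker_block
      rw [← e1, ← e2]
      ext i j
      have := Finset.ext_iff.1 heq (i, j)
      simpa [Setoid.ker_def] using this
    rfl
  · rw [toF, DirectSum.of_eq_of_ne _ _ _ (Ne.symm hlen)] at h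
    exact absurd rfl h

lemma linearIndependent_toF : LinearIndependent ℤ (toF : BlockWord A → F A) := by
  classical
  rw [linearIndependent_iff]
  intro l hl
  by_contra hne
  -- Triangularity: among the block words in a supposed relation, take one with the fewest pairs in
  -- a common block, and read off the coefficient at a permutation that descends exactly between its
  -- blocks.
  obtain ⟨d, hd, hmin⟩ := l.support.exists_min_image
    (fun d => (Finset.univ.filter fun p : Fin d.len × Fin d.len =>
      d.block p.1 = d.block p.2).card) (Finsupp.support_nonempty_iff.2 hne)
  obtain ⟨ρ, hρ⟩ := exists_perm_lt_iff d.monotone_block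
  let ev : F A →+ ℤ := (Finsupp.applyAddHom (permWord ρ d.word)).comp
    ((MonoidAlgebra.coeffAddEquiv (R := ℤ) (M := Wreath A d.len)).toAddMonoidHom.comp
      (DFinsupp.evalAddMonoidHom d.len))
  have h1 : ev (Finsupp.linearCombination ℤ toF l) = 0 := by rw [hl, map_zero]
  rw [Finsupp.linearCombination_apply, Finsupp.sum, map_sum, Finset.sum_eq_single d] at h1
  · have : ev d.toF = 1 := by
      change ((DirectSum.of (FComp A) d.len (shuffleProd d.block (d.letter ∘ d.block)))
        d.len).coeff (permWord ρ d.word) = 1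
      have hmem : ρ ∈ increasingOn d.block :=
        mem_increasingOn.2 fun i j hb hij => (hρ i j hij).2 hb
      rw [DirectSum.of_eq_same, coeff_shuffleProd, if_pos ⟨d.letter_comp_block, hmem⟩]
    rw [map_zsmul, this] at h1
    exact (Finsupp.mem_support_iff.1 hd) (by simpa using h1)
  · intro e he hed
    rw [map_zsmul]
    suffices ev e.toF = 0 by rw [this, smul_zero]
    by_contra hev
    exact hed (eq_of_coeff_toF_ne_zero hρ hev (hmin e he))
  · exact fun h => absurd hd h

lemma of_mul_of {m n : ℕ} (x : FComp A m) (y : FComp A n) :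
    DirectSum.of (FComp A) m x * DirectSum.of (FComp A) n y =
      DirectSum.of (FComp A) (m + n) (extMul A x y) :=
  DirectSum.of_mul_of x y

lemma one_mem_span_toF : (1 : F A) ∈ Submodule.span ℤ (Set.range (toF : BlockWord A → F A)) := by
  refine Submodule.subset_span ⟨ofBlock (n := 0) (fun _ => 0) monotone_const (fun _ => 1), ?_⟩
  rw [toF_ofBlock]
  change DirectSum.of _ _ (shuffleProd (fun _ : Fin 0 => 0) (fun _ => (1 : A))) = _
  rw [shuffleProd_const, yGen_zero]
  rfl

lemma yGen_mem_span_toF (n : ℕ) (v : MonoidAlgebra ℤ A) :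
    DirectSum.of (FComp A) n (yGen n v) ∈
      Submodule.span ℤ (Set.range (toF : BlockWord A → F A)) := by
  induction v using MonoidAlgebra.induction_linear with
  | zero => simp [yGen]
  | add x y hx hy =>
    rw [yGen, MonoidAlgebra.mapDomain_add, map_add]
    exact Submodule.add_mem _ hx hy
  | single a r =>
    have : yGen n (MonoidAlgebra.single a r) = r • yGen n (MonoidAlgebra.single a 1) := by
      simp [yGen]
    rw [this, map_zsmul]
    refine Submodule.smul_mem _ _ (Submodule.subset_span
      ⟨ofBlock (n := n) (fun _ => 0) monotone_const (fun _ => a), ?_⟩)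
    rw [toF_ofBlock, ← shuffleProd_const 0]
    rfl

/-- The basis is closed under the product. The concatenated word is exposed because the same word
computes the induction product of the corresponding characters. -/
lemma exists_toF_mul (d e : BlockWord A) : ∃ (b : Fin (d.len + e.len) → ℕ) (χ : ℕ → A)
    (hb : Monotone b), IsConcat d.block e.block b ∧
      (∀ i, χ (b (Fin.castAdd e.len i)) = d.letter (d.block i)) ∧
      (∀ i, χ (b (Fin.natAdd d.len i)) = e.letter (e.block i)) ∧
      d.toF * e.toF = (ofBlock b hb χ).toF := by
  obtain ⟨b, χ, hb, hc, hl, hr⟩ :=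
    exists_isConcat d.monotone_block e.monotone_block d.letter e.letter
  refine ⟨b, χ, hb, hc, hl, hr, ?_⟩
  rw [toF_ofBlock, toF, toF, of_mul_of, hc.extMul_shuffleProd, append_comp hl hr]

lemma mul_mem_span_toF {x y : F A} (hx : x ∈ Submodule.span ℤ (Set.range (toF : BlockWord A → F A)))
    (hy : y ∈ Submodule.span ℤ (Set.range (toF : BlockWord A → F A))) :
    x * y ∈ Submodule.span ℤ (Set.range (toF : BlockWord A → F A)) := by
  induction hx using Submodule.span_induction with
  | mem x hx =>
    obtain ⟨d, rfl⟩ := hx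
    induction hy using Submodule.span_induction with
    | mem y hy =>
      obtain ⟨e, rfl⟩ := hy
      obtain ⟨b, χ, hb, -, -, -, hf⟩ := exists_toF_mul d e
      exact hf ▸ Submodule.subset_span ⟨_, rfl⟩
    | zero => rw [mul_zero]; exact Submodule.zero_mem _
    | add y y' _ _ h h' => rw [mul_add]; exact Submodule.add_mem _ h h'
    | smul c y _ h => rw [mul_smul_comm]; exact Submodule.smul_mem _ c h
  | zero => rw [zero_mul]; exact Submodule.zero_mem _
  | add x x' _ _ h h' => rw [add_mul]; exact Submodule.add_mem _ h h'
  | smul c x _ h => rw [smul_mul_assoc]; exact Submodule.smul_mem _ c h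

/-- This inclusion suffices: the homomorphism is built on the span and then restricted. -/
lemma MR_le_span_toF : MR A ≤ Submodule.span ℤ (Set.range (toF : BlockWord A → F A)) :=
  sInf_le ⟨⟨one_mem_span_toF, fun _ hx _ hy => mul_mem_span_toF hx hy⟩, yGen_mem_span_toF⟩

end BlockWord

end Basis

/-! ### A symmetry of multisets of pairs of necklaces -/

section Symmetry

variable {n : ℕ}

/-- The letters that one reads off along the orbit of a point, ordered lexicographically. -/
def orbitWord (ρ : Equiv.Perm (Fin n)) (β : Fin n → ℕ) (p : Fin n) : Lex (ℕ → ℕ) :=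
  toLex fun t => β ((ρ ^ t) p)

lemma orbitWord_eq_iff {ρ : Equiv.Perm (Fin n)} {β : Fin n → ℕ} {p q : Fin n} :
    orbitWord ρ β p = orbitWord ρ β q ↔ ∀ t : ℕ, β ((ρ ^ t) p) = β ((ρ ^ t) q) := by
  rw [orbitWord, orbitWord, toLex_inj, funext_iff]

lemma orbitWord_apply_eq {ρ : Equiv.Perm (Fin n)} {β : Fin n → ℕ} {p q : Fin n}
    (h : orbitWord ρ β p = orbitWord ρ β q) : β p = β q :=
  orbitWord_eq_iff.1 h 0

lemma orbitWord_step_eq {ρ : Equiv.Perm (Fin n)} {β : Fin n → ℕ} {p q : Fin n}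
    (h : orbitWord ρ β p = orbitWord ρ β q) : orbitWord ρ β (ρ p) = orbitWord ρ β (ρ q) :=
  orbitWord_eq_iff.2 fun t => by
    simpa [pow_succ] using orbitWord_eq_iff.1 h (t + 1)

lemma orbitWord_inv_step_eq {ρ : Equiv.Perm (Fin n)} {β : Fin n → ℕ} {p q : Fin n}
    (h : orbitWord ρ β p = orbitWord ρ β q) : orbitWord ρ β (ρ⁻¹ p) = orbitWord ρ β (ρ⁻¹ q) := by
  -- Finite order makes `ρ⁻¹` a nonnegative power of `ρ`, so equality of forward words also
  -- propagates backwards.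
  obtain ⟨k, hk⟩ : ∃ k : ℕ, ρ⁻¹ = ρ ^ k :=
    ⟨orderOf ρ - 1, by
      rw [inv_eq_iff_mul_eq_one, ← pow_succ', Nat.sub_add_cancel (orderOf_pos ρ),
        pow_orderOf_eq_one]⟩
  rw [hk, orbitWord_eq_iff]
  intro t
  rw [← Equiv.Perm.mul_apply, ← Equiv.Perm.mul_apply, ← pow_add]
  exact orbitWord_eq_iff.1 h (t + k)

lemma orbitWord_lt_iff {ρ : Equiv.Perm (Fin n)} {β : Fin n → ℕ} {p q : Fin n} :
    orbitWord ρ β p < orbitWord ρ β q ↔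
      ∃ t : ℕ, (∀ s < t, β ((ρ ^ s) p) = β ((ρ ^ s) q)) ∧ β ((ρ ^ t) p) < β ((ρ ^ t) q) :=
  Iff.rfl

lemma orbitWord_lt_cases {ρ : Equiv.Perm (Fin n)} {β : Fin n → ℕ} {p q : Fin n}
    (h : orbitWord ρ β p < orbitWord ρ β q) :
    β p < β q ∨ β p = β q ∧ orbitWord ρ β (ρ p) < orbitWord ρ β (ρ q) := by
  obtain ⟨t, h1, h2⟩ := orbitWord_lt_iff.1 h
  rcases t with _ | t
  · exact Or.inl h2
  · refine Or.inr ⟨h1 0 t.succ_pos, orbitWord_lt_iff.2 ⟨t, fun s hs => ?_, ?_⟩⟩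
    · simpa [pow_succ] using h1 (s + 1) (Nat.succ_lt_succ hs)
    · simpa [pow_succ] using h2

/-- A coinduction principle: as long as the letters agree, `T` is carried along both orbits, so at
the first difference it decides the comparison. -/
lemma orbitWord_le_of_rel {ρ : Equiv.Perm (Fin n)} {β : Fin n → ℕ} (T : Fin n → Fin n → Prop)
    (h1 : ∀ p q, T p q → β p ≤ β q) (h2 : ∀ p q, T p q → β p = β q → T (ρ p) (ρ q))
    {p q : Fin n} (hT : T p q) : orbitWord ρ β p ≤ orbitWord ρ β q := by
  by_contra hlt
  obtain ⟨t, ht, hlt⟩ := orbitWord_lt_iff.1 (not_le.1 hlt)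
  have key : ∀ s ≤ t, T ((ρ ^ s) p) ((ρ ^ s) q) := by
    intro s
    induction s with
    | zero => intro _; exact hT
    | succ s ih =>
      intro hs
      rw [pow_succ', Equiv.Perm.mul_apply, Equiv.Perm.mul_apply]
      exact h2 _ _ (ih (Nat.le_of_succ_le hs)) (ht s hs).symm
  exact (h1 _ _ (key t le_rfl)).not_gt hlt

lemma orbitWord_le_zero {ρ : Equiv.Perm (Fin n)} {β : Fin n → ℕ} {p q : Fin n}
    (h : orbitWord ρ β p ≤ orbitWord ρ β q) : β p ≤ β q := by
  rcases h.lt_or_eq with h | h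
  · rcases orbitWord_lt_cases h with h | h
    exacts [h.le, h.1.le]
  · exact (orbitWord_apply_eq h).le

lemma orbitWord_comp_eq {ρ τ : Equiv.Perm (Fin n)} {β : Fin n → ℕ} (hc : Commute ρ τ)
    (hβ : β ∘ τ = β) (p : Fin n) : orbitWord ρ β (τ p) = orbitWord ρ β p := by
  rw [orbitWord_eq_iff]
  intro t
  rw [← Equiv.Perm.mul_apply, (hc.pow_left t).eq, Equiv.Perm.mul_apply]
  exact congrFun hβ _

/-- `ρ` increases on the fibres of `b ∘ e` for the order given by the ranks `e`. -/
def IncreasesOn (b : Fin n → ℕ) (e ρ : Equiv.Perm (Fin n)) : Prop :=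
  ∀ p q, b (e p) = b (e q) → e p < e q → e (ρ p) < e (ρ q)

lemma IncreasesOn.orbitWord_le {b : Fin n → ℕ} (hb : Monotone b) {e ρ : Equiv.Perm (Fin n)}
    (h : IncreasesOn b e ρ) {p q : Fin n} (hpq : e p < e q) :
    orbitWord ρ (b ∘ e) p ≤ orbitWord ρ (b ∘ e) q :=
  orbitWord_le_of_rel (fun p q => e p < e q) (fun _ _ h => hb h.le)
    (fun p q hpq hb => h p q hb hpq) hpq

lemma IncreasesOn.lt_of_orbitWord_lt {b : Fin n → ℕ} (hb : Monotone b) {e ρ : Equiv.Perm (Fin n)}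
    (h : IncreasesOn b e ρ) {p q : Fin n}
    (hpq : orbitWord ρ (b ∘ e) p < orbitWord ρ (b ∘ e) q) : e p < e q := by
  by_contra hlt
  rcases (not_lt.1 hlt).lt_or_eq with hlt | heq
  · exact (h.orbitWord_le hb hlt).not_gt hpq
  · rw [e.injective heq] at hpq
    exact lt_irrefl _ hpq

/-- Two commuting permutations `ρ` and `τ` whose pairs of orbit words arrange the points into
tori, the points being ranked by `e` and by `e'` according to these words. -/
structure IsTorusPair (b d : Fin n → ℕ) (e ρ e' τ : Equiv.Perm (Fin n)) : Prop where
  incr : IncreasesOn b e ρ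
  incr' : IncreasesOn d e' τ
  comp : (b ∘ e) ∘ τ = b ∘ e
  comp' : (d ∘ e') ∘ ρ = d ∘ e'
  comm : Commute ρ τ
  tie : ∀ p q, orbitWord ρ (b ∘ e) p = orbitWord ρ (b ∘ e) q →
    orbitWord τ (d ∘ e') p = orbitWord τ (d ∘ e') q → (e p < e q ↔ e' p < e' q)
  lex : ∀ p q, orbitWord ρ (b ∘ e) p = orbitWord ρ (b ∘ e) q →
    orbitWord τ (d ∘ e') p < orbitWord τ (d ∘ e') q → e p < e q
  lex' : ∀ p q, orbitWord τ (d ∘ e') p = orbitWord τ (d ∘ e') q →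
    orbitWord ρ (b ∘ e) p < orbitWord ρ (b ∘ e) q → e' p < e' q

lemma IsTorusPair.symm {b d : Fin n → ℕ} {e ρ e' τ : Equiv.Perm (Fin n)}
    (h : IsTorusPair b d e ρ e' τ) : IsTorusPair d b e' τ e ρ where
  incr := h.incr'
  incr' := h.incr
  comp := h.comp'
  comp' := h.comp
  comm := h.comm.symm
  tie p q h1 h2 := (h.tie p q h2 h1).symm
  lex := h.lex'
  lex' := h.lex

/-- `τ` sorts each class of points with the same orbit word by the values of `κ`. -/
structure SortsClasses (b : Fin n → ℕ) (e ρ : Equiv.Perm (Fin n)) (κ : Fin n → ℕ)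
    (τ : Equiv.Perm (Fin n)) : Prop where
  word : ∀ p, orbitWord ρ (b ∘ e) (τ p) = orbitWord ρ (b ∘ e) p
  sort : ∀ p q, orbitWord ρ (b ∘ e) p = orbitWord ρ (b ∘ e) q → e p < e q →
    κ (τ p) < κ (τ q) ∨ κ (τ p) = κ (τ q) ∧ e (τ p) < e (τ q)

/-- The key by which the points are ordered in the construction of a `SortsClasses`. -/
def classKey (b : Fin n → ℕ) (e ρ : Equiv.Perm (Fin n)) (κ : Fin n → ℕ) (p : Fin n) :
    Lex (ℕ → ℕ) ×ₗ (ℕ ×ₗ Fin n) :=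
  toLex (orbitWord ρ (b ∘ e) p, toLex (κ p, e p))

lemma exists_rank_classKey (b : Fin n → ℕ) (e ρ : Equiv.Perm (Fin n)) (κ : Fin n → ℕ) :
    ∃ r : Equiv.Perm (Fin n), ∀ p q, r p < r q ↔ classKey b e ρ κ p < classKey b e ρ κ q := by
  refine exists_rank fun p q h => ?_
  have h1 := (Prod.ext_iff.1 (toLex.injective h)).2
  exact e.injective (Prod.ext_iff.1 (toLex.injective h1)).2

/-- Since `τ` preserves orbit words, sorting says that the keys of the points `τ p` increase in the
order `e`. As `r` ranks these keys, `τ` is determined. -/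
lemma SortsClasses.mul_eq {b : Fin n → ℕ} (hb : Monotone b) {e ρ : Equiv.Perm (Fin n)}
    (he : IncreasesOn b e ρ) {κ : Fin n → ℕ} {τ : Equiv.Perm (Fin n)}
    (h : SortsClasses b e ρ κ τ) {r : Equiv.Perm (Fin n)}
    (hr : ∀ p q, r p < r q ↔ classKey b e ρ κ p < classKey b e ρ κ q) : e = r * τ := by
  refine perm_eq_of_lt_iff fun p q hpq => ?_
  rw [Equiv.Perm.mul_apply, Equiv.Perm.mul_apply, hr, classKey, classKey,
    Prod.Lex.toLex_lt_toLex, Prod.Lex.toLex_lt_toLex]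
  simp only [h.word]
  rcases (he.orbitWord_le hb hpq).lt_or_eq with hlt | heq
  · exact Or.inl hlt
  · exact Or.inr ⟨heq, h.sort p q heq hpq⟩

lemma SortsClasses.unique {b : Fin n → ℕ} (hb : Monotone b) {e ρ : Equiv.Perm (Fin n)}
    (he : IncreasesOn b e ρ) {κ : Fin n → ℕ} {τ τ' : Equiv.Perm (Fin n)}
    (h : SortsClasses b e ρ κ τ) (h' : SortsClasses b e ρ κ τ') : τ = τ' := by
  obtain ⟨r, hr⟩ := exists_rank_classKey b e ρ κ
  exact mul_left_cancel ((h.mul_eq hb he hr).symm.trans (h'.mul_eq hb he hr))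

lemma exists_sortsClasses {b : Fin n → ℕ} (hb : Monotone b) {e ρ : Equiv.Perm (Fin n)}
    (he : IncreasesOn b e ρ) (κ : Fin n → ℕ) : ∃ τ, SortsClasses b e ρ κ τ := by
  obtain ⟨r, hr⟩ := exists_rank_classKey b e ρ κ
  have hmono : ∀ p q, r p ≤ r q → orbitWord ρ (b ∘ e) p ≤ orbitWord ρ (b ∘ e) q := by
    intro p q hpq
    rcases hpq.lt_or_eq with hlt | heq
    · rw [hr, classKey, classKey, Prod.Lex.toLex_lt_toLex] at hlt
      rcases hlt with hlt | ⟨heq, _⟩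
      exacts [hlt.le, heq.le]
    · rw [r.injective heq]
  have hmono' : ∀ p q, e p ≤ e q → orbitWord ρ (b ∘ e) p ≤ orbitWord ρ (b ∘ e) q := by
    intro p q hpq
    rcases hpq.lt_or_eq with hlt | heq
    · exact he.orbitWord_le hb hlt
    · rw [e.injective heq]
  have hword := Tuple.unique_monotone (f := orbitWord ρ (b ∘ e)) (σ := r⁻¹) (τ := e⁻¹)
    (fun i j hij => hmono _ _ (by simpa using hij))
    (fun i j hij => hmono' _ _ (by simpa using hij))
  have hw : ∀ p, orbitWord ρ (b ∘ e) ((r⁻¹ * e) p) = orbitWord ρ (b ∘ e) p := fun p => by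
    simpa using congrFun hword (e p)
  refine ⟨r⁻¹ * e, hw, fun p q hpq hlt => ?_⟩
  have hlt' : r ((r⁻¹ * e) p) < r ((r⁻¹ * e) q) := by simpa using hlt
  rw [hr, classKey, classKey, Prod.Lex.toLex_lt_toLex, Prod.Lex.toLex_lt_toLex] at hlt'
  simp only [hw] at hlt'
  exact (hlt'.resolve_left hpq.not_lt).2

/-- As `κ` is constant on the cycles of `ρ`, the conjugate `ρ τ ρ⁻¹` sorts the classes too;
uniqueness identifies it with `τ`. -/
lemma SortsClasses.commute {b : Fin n → ℕ} (hb : Monotone b) {e ρ : Equiv.Perm (Fin n)}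
    (he : IncreasesOn b e ρ) {κ : Fin n → ℕ} (hκ : κ ∘ ρ = κ) {τ : Equiv.Perm (Fin n)}
    (h : SortsClasses b e ρ κ τ) : Commute ρ τ := by
  have hκ' : ∀ p, κ (ρ p) = κ p := fun p => congrFun hκ p
  suffices SortsClasses b e ρ κ (ρ * τ * ρ⁻¹) by
    have := this.unique hb he h
    exact mul_inv_eq_iff_eq_mul.1 this
  refine ⟨fun p => ?_, fun p q hpq hlt => ?_⟩
  · have := orbitWord_step_eq (h.word (ρ⁻¹ p))
    simpa using this
  · have hpq' := orbitWord_inv_step_eq hpq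
    have hlt' : e (ρ⁻¹ p) < e (ρ⁻¹ q) := by
      by_contra hge
      rcases (not_lt.1 hge).lt_or_eq with hgt | heq
      · have := he _ _ (orbitWord_apply_eq hpq').symm hgt
        rw [perm_apply_inv_self, perm_apply_inv_self] at this
        exact lt_asymm this hlt
      · rw [ρ⁻¹.injective (e.injective heq)] at hlt
        exact lt_irrefl _ hlt
    simp only [Equiv.Perm.mul_apply, hκ']
    rcases h.sort _ _ hpq' hlt' with h1 | ⟨h1, h2⟩
    · exact Or.inl h1
    · refine Or.inr ⟨h1, he _ _ ?_ h2⟩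
      have := orbitWord_apply_eq ((h.word (ρ⁻¹ p)).trans (hpq'.trans (h.word (ρ⁻¹ q)).symm))
      exact this

/-- Here `κ (τ p) = d (e' p)` is the first letter of the `τ`-word of `p`. Within a `ρ`-class, `e`
orders points by their `τ`-words, with ties broken as in `e'`; a first-letter tie is passed on to `τ
p` and `τ q`. -/
lemma IsTorusPair.sortsClasses {b d : Fin n → ℕ} {e ρ e' τ : Equiv.Perm (Fin n)}
    (h : IsTorusPair b d e ρ e' τ) : SortsClasses b e ρ (d ∘ e' ∘ ⇑τ⁻¹) τ := by
  have hw := orbitWord_comp_eq h.comm h.comp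
  refine ⟨hw, fun p q hpq hlt => ?_⟩
  simp only [Function.comp_apply, perm_inv_apply_self]
  have hpq' : orbitWord ρ (b ∘ e) (τ p) = orbitWord ρ (b ∘ e) (τ q) := by rw [hw, hw, hpq]
  rcases lt_trichotomy (orbitWord τ (d ∘ e') p) (orbitWord τ (d ∘ e') q) with h1 | h1 | h1
  · rcases orbitWord_lt_cases h1 with h2 | ⟨h2, h3⟩
    · exact Or.inl h2
    · exact Or.inr ⟨h2, h.lex _ _ hpq' h3⟩
  · have h2 := orbitWord_apply_eq h1
    refine Or.inr ⟨h2, (h.tie _ _ hpq' (orbitWord_step_eq h1)).2 ?_⟩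
    exact h.incr' _ _ h2 ((h.tie _ _ hpq h1).1 hlt)
  · exact absurd (h.lex _ _ hpq.symm h1) (lt_asymm hlt)

/-- The word `d ∘ e' ∘ τ⁻¹` determines `τ` through sorting, hence `d ∘ e'` and the `τ`-words. Then
`e'` is forced: it ranks by `τ`-word, next by `ρ`-word, next by `e`. -/
lemma IsTorusPair.unique {b d : Fin n → ℕ} (hb : Monotone b) (hd : Monotone d)
    {e ρ e' τ e₁ τ₁ : Equiv.Perm (Fin n)} (h : IsTorusPair b d e ρ e' τ)
    (h₁ : IsTorusPair b d e ρ e₁ τ₁) (heq : d ∘ e' ∘ ⇑τ⁻¹ = d ∘ e₁ ∘ ⇑τ₁⁻¹) :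
    e' = e₁ ∧ τ = τ₁ := by
  obtain rfl : τ = τ₁ := by
    have h2 := h₁.sortsClasses
    rw [← heq] at h2
    exact h.sortsClasses.unique hb h.incr h2
  refine ⟨?_, rfl⟩
  have hde : d ∘ e' = d ∘ e₁ := by
    funext p
    simpa using congrFun heq (τ p)
  refine perm_eq_of_lt_iff fun p q hpq => ?_
  rcases lt_trichotomy (orbitWord τ (d ∘ e') p) (orbitWord τ (d ∘ e') q) with h1 | h1 | h1
  · rw [hde] at h1
    exact h₁.incr'.lt_of_orbitWord_lt hd h1
  · rcases lt_trichotomy (orbitWord ρ (b ∘ e) p) (orbitWord ρ (b ∘ e) q) with h2 | h2 | h2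
    · exact h₁.lex' _ _ (hde ▸ h1) h2
    · exact (h₁.tie _ _ h2 (hde ▸ h1)).1 ((h.tie _ _ h2 h1).2 hpq)
    · exact absurd (h.lex' _ _ h1.symm h2) (lt_asymm hpq)
  · exact absurd (h.incr'.lt_of_orbitWord_lt hd h1) (lt_asymm hpq)

lemma exists_isTorusPair {b d : Fin n → ℕ} (hb : Monotone b) (hd : Monotone d)
    {e ρ : Equiv.Perm (Fin n)} (he : IncreasesOn b e ρ) {κ : Fin n → ℕ} (hκ : κ ∘ ρ = κ)
    (hκd : κ ∈ arrangements d) :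
    ∃ e' τ, IsTorusPair b d e ρ e' τ ∧ d ∘ e' ∘ ⇑τ⁻¹ = κ := by
  obtain ⟨τ, hτ⟩ := exists_sortsClasses hb he κ
  have hcomm := hτ.commute hb he hκ
  -- The ranking is the one forced by uniqueness, with `κ ∘ τ` standing for the word `d ∘ e'` that
  -- is still to be identified.
  obtain ⟨e', he'⟩ := exists_rank (k := fun p => toLex (orbitWord τ (κ ∘ τ) p,
      toLex (orbitWord ρ (b ∘ e) p, e p))) (fun p q h => by
    have h1 := (Prod.ext_iff.1 (toLex.injective h)).2
    exact e.injective (Prod.ext_iff.1 (toLex.injective h1)).2)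
  simp only [Prod.Lex.toLex_lt_toLex] at he'
  have hde : d ∘ e' = κ ∘ τ := by
    obtain ⟨π, hπ⟩ := mem_arrangements.1 (comp_perm_mem_arrangements hκd τ)
    -- Both `e'⁻¹` and `π⁻¹` sort `κ ∘ τ` into a monotone word; the word sorted by `π⁻¹` is `d`.
    have hu := Tuple.unique_monotone (f := κ ∘ τ) (σ := e'⁻¹) (τ := π⁻¹)
      (fun i j hij => by
        rcases hij.lt_or_eq with hlt | rfl
        · have := (he' (e'⁻¹ i) (e'⁻¹ j)).1 (by simpa using hlt)
          rcases this with h1 | ⟨h1, _⟩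
          · exact orbitWord_le_zero (p := e'⁻¹ i) (q := e'⁻¹ j) h1.le
          · exact orbitWord_le_zero (p := e'⁻¹ i) (q := e'⁻¹ j) h1.le
        · exact le_rfl)
      (by
        rw [← hπ]
        intro i j hij
        simpa using hd hij)
    funext p
    have := congrFun hu (e' p)
    rw [← hπ] at this ⊢
    simpa using this.symm
  have hκτ : d ∘ e' ∘ ⇑τ⁻¹ = κ := by
    funext p
    have := congrFun hde (τ⁻¹ p)
    simpa using this
  -- Coinduction along `τ`: on a `ρ`-class, sorting yields either a strictly smaller letter or the
  -- same `e`-order at the images under `τ`.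
  have hsort : ∀ p q, orbitWord ρ (b ∘ e) p = orbitWord ρ (b ∘ e) q → e p < e q →
      orbitWord τ (κ ∘ τ) p ≤ orbitWord τ (κ ∘ τ) q := by
    intro p q hpq hlt
    refine orbitWord_le_of_rel
      (fun p q => orbitWord ρ (b ∘ e) p = orbitWord ρ (b ∘ e) q ∧ e p < e q) ?_ ?_ ⟨hpq, hlt⟩
    · rintro p q ⟨h1, h2⟩
      rcases hτ.sort p q h1 h2 with h | h
      exacts [h.le, h.1.le]
    · rintro p q ⟨h1, h2⟩ h3
      refine ⟨by rw [hτ.word, hτ.word, h1], ?_⟩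
      exact ((hτ.sort p q h1 h2).resolve_left h3.not_lt).2
  refine ⟨e', τ, ⟨he, fun p q hpq hlt => ?_, ?_, ?_, hcomm, ?_, ?_, ?_⟩, hκτ⟩
  · have hpq' : (κ ∘ τ) p = (κ ∘ τ) q := by rw [← hde]; exact hpq
    rw [he'] at hlt ⊢
    rw [hτ.word, hτ.word]
    rcases hlt with h1 | ⟨h1, h2⟩
    · exact Or.inl ((orbitWord_lt_cases h1).resolve_left hpq'.not_lt).2
    · refine Or.inr ⟨orbitWord_step_eq h1, h2.imp_right fun h3 => ⟨h3.1, ?_⟩⟩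
      exact ((hτ.sort p q h3.1 h3.2).resolve_left hpq'.not_lt).2
  · funext p; exact orbitWord_apply_eq (hτ.word p)
  · rw [hde]
    funext p
    have : τ (ρ p) = ρ (τ p) := (congrArg (fun π => π p) hcomm.eq).symm
    simp only [Function.comp_apply, this]
    exact congrFun hκ (τ p)
  · intro p q h1 h2
    rw [hde] at h2
    rw [he']
    simp [h1, h2]
  · intro p q h1 h2
    rw [hde] at h2
    by_contra hge
    rcases (not_lt.1 hge).lt_or_eq with hgt | heq
    · exact (hsort q p h1.symm hgt).not_gt h2
    · rw [e.injective heq] at h2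
      exact lt_irrefl _ h2
  · intro p q h1 h2
    rw [hde] at h1
    rw [he']
    exact Or.inr ⟨h1, Or.inl h2⟩

open Classical in
/-- The sum over the permutations `ρ` increasing on the fibres of `b` of the values at `ρ` of a
weighted permutation character on the rearrangements of `d`. -/
def wordPairing (z : ℕ → ℕ → ℂ) (b d : Fin n → ℕ) : ℂ :=
  ∑ ρ ∈ increasingOn b, ∑ κ ∈ arrangements d,
    if κ ∘ ρ = κ then ∏ p, z (b p) (κ p) else 0

open Classical in
/-- The sum of the weights of all torus pairs. -/
def torusSum (z : ℕ → ℕ → ℂ) (b d : Fin n → ℕ) : ℂ :=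
  ∑ x ∈ Finset.univ.filter (fun x : (Equiv.Perm (Fin n) × Equiv.Perm (Fin n)) ×
      Equiv.Perm (Fin n) × Equiv.Perm (Fin n) => IsTorusPair b d x.1.1 x.1.2 x.2.1 x.2.2),
    ∏ p, z (b (x.1.1 p)) (d (x.2.1 p))

lemma torusSum_symm (z : ℕ → ℕ → ℂ) (b d : Fin n → ℕ) :
    torusSum z b d = torusSum (fun i j => z j i) d b := by
  refine Finset.sum_bij' (fun x _ => (x.2, x.1)) (fun x _ => (x.2, x.1)) ?_ ?_ ?_ ?_ ?_
  · intro x hx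
    simp only [Finset.mem_filter, Finset.mem_univ, true_and] at hx ⊢
    exact hx.symm
  · intro x hx
    simp only [Finset.mem_filter, Finset.mem_univ, true_and] at hx ⊢
    exact hx.symm
  all_goals intros; rfl

lemma increasesOn_iff {b : Fin n → ℕ} {e ρ : Equiv.Perm (Fin n)} :
    IncreasesOn b e ρ ↔ e * ρ * e⁻¹ ∈ increasingOn b := by
  rw [mem_increasingOn]
  constructor
  · intro h i j hb hij
    simpa using h (e⁻¹ i) (e⁻¹ j) (by simpa using hb) (by simpa using hij)
  · intro h p q hb hpq
    simpa using h (e p) (e q) hb hpq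

/-- The factor `n!` counts the free choice of the ranking `e`. Transported by `e`, a pair `(ρ₀, κ₀)`
becomes `ρ = e⁻¹ ρ₀ e` and `κ = κ₀ ∘ e`, which extend to exactly one torus pair with `d ∘ e' ∘ τ⁻¹ =
κ`. -/
lemma factorial_mul_wordPairing (z : ℕ → ℕ → ℂ) {b d : Fin n → ℕ} (hb : Monotone b)
    (hd : Monotone d) : n.factorial * wordPairing z b d = torusSum z b d := by
  classical
  have h0 : (n.factorial : ℂ) * wordPairing z b d =
      ∑ x ∈ (Finset.univ : Finset (Equiv.Perm (Fin n))) ×ˢ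
        ((increasingOn b ×ˢ arrangements d).filter fun y => y.2 ∘ y.1 = y.2),
        ∏ p, z (b p) (x.2.2 p) := by
    rw [Finset.sum_product]
    dsimp only
    rw [Finset.sum_const, Finset.card_univ, Fintype.card_perm,
      Fintype.card_fin, nsmul_eq_mul, Finset.sum_filter, Finset.sum_product, wordPairing]
  rw [h0, torusSum]
  symm
  refine Finset.sum_bij
    (fun x _ => (x.1.1, x.1.1 * x.1.2 * x.1.1⁻¹, d ∘ x.2.1 ∘ ⇑x.2.2⁻¹ ∘ ⇑x.1.1⁻¹)) ?_ ?_ ?_ ?_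
  · rintro ⟨⟨e, ρ⟩, e', τ⟩ hx
    simp only [Finset.mem_filter, Finset.mem_univ, true_and, Finset.mem_product] at hx ⊢
    refine ⟨⟨increasesOn_iff.1 hx.incr, mem_arrangements.2 ⟨e' * τ⁻¹ * e⁻¹, rfl⟩⟩, ?_⟩
    funext p
    have h1 : τ⁻¹ (ρ (e⁻¹ p)) = ρ (τ⁻¹ (e⁻¹ p)) :=
      congrArg (fun π => π (e⁻¹ p)) hx.comm.inv_right.eq.symm
    have h2 := congrFun hx.comp' (τ⁻¹ (e⁻¹ p))
    simp only [Function.comp_apply, Equiv.Perm.mul_apply, perm_inv_apply_self, h1] at h2 ⊢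
    exact h2
  · rintro ⟨⟨e, ρ⟩, e', τ⟩ hx ⟨⟨e₁, ρ₁⟩, e₁', τ₁⟩ hx₁ heq
    simp only [Finset.mem_filter, Finset.mem_univ, true_and] at hx hx₁
    simp only [Prod.mk.injEq] at heq
    obtain ⟨rfl, h1, h2⟩ := heq
    obtain rfl : ρ = ρ₁ := mul_left_cancel (mul_right_cancel h1)
    have h3 : d ∘ e' ∘ ⇑τ⁻¹ = d ∘ e₁' ∘ ⇑τ₁⁻¹ := by
      funext p
      simpa using congrFun h2 (e p)
    obtain ⟨rfl, rfl⟩ := hx.unique hb hd hx₁ h3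
    rfl
  · rintro ⟨e, ρ₀, κ₀⟩ hx
    simp only [Finset.mem_filter, Finset.mem_univ, true_and, Finset.mem_product] at hx
    obtain ⟨⟨hρ, hκ⟩, hfix⟩ := hx
    obtain ⟨e', τ, hT, hκτ⟩ := exists_isTorusPair hb hd (e := e) (ρ := e⁻¹ * ρ₀ * e)
      (increasesOn_iff.2 (by simpa [mul_assoc] using hρ)) (κ := κ₀ ∘ e)
      (by funext p; simpa using congrFun hfix (e p)) (comp_perm_mem_arrangements hκ e)
    refine ⟨((e, e⁻¹ * ρ₀ * e), e', τ), by simpa using hT, ?_⟩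
    simp only [Prod.mk.injEq, true_and]
    refine ⟨by group, ?_⟩
    funext p
    simpa using congrFun hκτ (e⁻¹ p)
  · rintro ⟨⟨e, ρ⟩, e', τ⟩ hx
    simp only [Finset.mem_filter, Finset.mem_univ, true_and] at hx
    -- Substituting `e (τ p)` turns the second letter into `d (e' p)`, and the first is unchanged
    -- because `b ∘ e` is `τ`-invariant.
    rw [← Equiv.prod_comp (e * τ)
      (fun p => z (b p) ((d ∘ e' ∘ ⇑τ⁻¹ ∘ ⇑e⁻¹) p))]
    refine Finset.prod_congr rfl fun p _ => ?_
    have := congrFun hx.comp p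
    simp only [Function.comp_apply] at this
    simp [this]

/-- The symmetry of the pairing. -/
theorem wordPairing_symm (z : ℕ → ℕ → ℂ) {b d : Fin n → ℕ} (hb : Monotone b) (hd : Monotone d) :
    wordPairing z b d = wordPairing (fun i j => z j i) d b := by
  have h := factorial_mul_wordPairing z hb hd
  rw [torusSum_symm, ← factorial_mul_wordPairing _ hd hb] at h
  exact mul_left_cancel₀ (by exact_mod_cast n.factorial_ne_zero) h

end Symmetry

/-! ### Existence and uniqueness of the Solomon homomorphism -/

section Solomon

variable {A G : Type*} [CommGroup A] [CommGroup G] [Finite G] (e : A ≃* (G →* ℂˣ))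

/-- The product of characters `η_k(e a)` that belongs to a word with blocks. -/
def BlockWord.toFun (d : BlockWord A) : Fun G :=
  DirectSum.of (FunComp G) d.len (youngInd (e ∘ d.letter) d.block)

lemma BlockWord.toFun_ofBlock {n : ℕ} (b : Fin n → ℕ) (hb : Monotone b) (χ : ℕ → A) :
    (BlockWord.ofBlock b hb χ).toFun e = DirectSum.of (FunComp G) n (youngInd (e ∘ χ) b) := by
  refine congrArg (DirectSum.of (FunComp G) n)
    (youngInd_congr (BlockWord.block_ofBlock b hb χ) ?_)
  exact congrArg (e ∘ ·) (BlockWord.letter_ofBlock b hb χ)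

lemma fun_of_mul_of {m n : ℕ} (x : FunComp G m) (y : FunComp G n) :
    DirectSum.of (FunComp G) m x * DirectSum.of (FunComp G) n y =
      DirectSum.of (FunComp G) (m + n) (indMul G x y) :=
  DirectSum.of_mul_of x y

/-- The Solomon homomorphism on the span of the products of the elements `y_{n,a}`. -/
def solomonSpan :
    Submodule.span ℤ (Set.range (BlockWord.toF : BlockWord A → F A)) →ₗ[ℤ] Fun G :=
  Finsupp.linearCombination ℤ (BlockWord.toFun e) ∘ₗ BlockWord.linearIndependent_toF.repr

lemma solomonSpan_toF (d : BlockWord A) (h) : solomonSpan e ⟨d.toF, h⟩ = d.toFun e := by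
  have := BlockWord.linearIndependent_toF.repr_eq_single d ⟨d.toF, h⟩ rfl
  simp [solomonSpan, this]

lemma solomonSpan_yGen (n : ℕ) (a : A) (h) :
    solomonSpan e ⟨DirectSum.of (FComp A) n (yGen n (MonoidAlgebra.single a 1)), h⟩ =
      DirectSum.of (FunComp G) n (eta n (e a)) := by
  have h1 : DirectSum.of (FComp A) n (yGen n (MonoidAlgebra.single a 1)) =
      (BlockWord.ofBlock (n := n) (fun _ => 0) monotone_const (fun _ => a)).toF := by
    rw [BlockWord.toF_ofBlock, ← shuffleProd_const 0]
    rfl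
  simp only [h1]
  rw [solomonSpan_toF, BlockWord.toFun_ofBlock, youngInd_const]
  rfl

lemma solomonSpan_one (h) : solomonSpan e ⟨1, h⟩ = 1 := by
  have h1 : (1 : F A) = DirectSum.of (FComp A) 0 (yGen 0 (MonoidAlgebra.single 1 1)) := by
    rw [yGen_zero]
    rfl
  simp only [h1]
  rw [solomonSpan_yGen]
  refine congrArg (DirectSum.of (FunComp G) 0) ?_
  funext w
  rw [eta, map_one, MonoidHom.one_apply, Units.val_one]
  rfl

/-- The graph of the Solomon homomorphism. -/
def solomonGraph : Submodule ℤ (F A × Fun G) :=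
  Submodule.span ℤ (Set.range fun d : BlockWord A => (d.toF, d.toFun e))

lemma mem_solomonGraph (x : Submodule.span ℤ (Set.range (BlockWord.toF : BlockWord A → F A))) :
    ((x : F A), solomonSpan e x) ∈ solomonGraph e := by
  have key : ∀ l : BlockWord A →₀ ℤ, (Finsupp.linearCombination ℤ BlockWord.toF l,
      Finsupp.linearCombination ℤ (BlockWord.toFun e) l) ∈ solomonGraph e := by
    intro l
    induction l using Finsupp.induction_linear with
    | zero => simp only [map_zero]; exact Submodule.zero_mem _
    | add l l' h h' =>
      rw [map_add, map_add, ← Prod.mk_add_mk]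
      exact Submodule.add_mem _ h h'
    | single d c =>
      rw [Finsupp.linearCombination_single, Finsupp.linearCombination_single, ← Prod.smul_mk]
      exact Submodule.smul_mem (solomonGraph e) c (Submodule.subset_span ⟨d, rfl⟩)
  have h := key (BlockWord.linearIndependent_toF.repr x)
  rwa [BlockWord.linearIndependent_toF.linearCombination_repr] at h

/-- With `mem_solomonGraph`, the span of the pairs is exactly the graph of a function.
Multiplicativity therefore amounts to the span being closed under products, which is checked on
generators. -/
lemma exists_solomonSpan_of_mem {p : F A × Fun G} (hp : p ∈ solomonGraph e) :
    ∃ x : Submodule.span ℤ (Set.range (BlockWord.toF : BlockWord A → F A)),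
      ((x : F A), solomonSpan e x) = p := by
  have : solomonGraph e ≤ LinearMap.range ((Submodule.subtype _).prod (solomonSpan e)) := by
    refine Submodule.span_le.2 ?_
    rintro _ ⟨d, rfl⟩
    exact ⟨⟨d.toF, Submodule.subset_span ⟨d, rfl⟩⟩, Prod.ext rfl (solomonSpan_toF e d _)⟩
  exact this hp

lemma toF_mul_mem_solomonGraph (d d' : BlockWord A) :
    (d.toF, d.toFun e) * (d'.toF, d'.toFun e) ∈ solomonGraph e := by
  obtain ⟨b, χ, hb, hc, hl, hr, hf⟩ := BlockWord.exists_toF_mul d d'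
  refine Submodule.subset_span ⟨BlockWord.ofBlock b hb χ, Prod.ext hf.symm ?_⟩
  change (BlockWord.ofBlock b hb χ).toFun e = d.toFun e * d'.toFun e
  rw [BlockWord.toFun_ofBlock, BlockWord.toFun, BlockWord.toFun, fun_of_mul_of,
    hc.indMul_youngInd (χ'' := e ∘ χ) (fun i => by simp [hl]) (fun i => by simp [hr])]

lemma mul_mem_solomonGraph {p q : F A × Fun G} (hp : p ∈ solomonGraph e)
    (hq : q ∈ solomonGraph e) : p * q ∈ solomonGraph e := by
  induction hp using Submodule.span_induction with
  | mem p hp =>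
    obtain ⟨d, rfl⟩ := hp
    induction hq using Submodule.span_induction with
    | mem q hq =>
      obtain ⟨d', rfl⟩ := hq
      exact toF_mul_mem_solomonGraph e d d'
    | zero => rw [mul_zero]; exact Submodule.zero_mem _
    | add y y' _ _ h h' => rw [mul_add]; exact Submodule.add_mem _ h h'
    | smul c y _ h => rw [mul_smul_comm]; exact Submodule.smul_mem _ c h
  | zero => rw [zero_mul]; exact Submodule.zero_mem _
  | add x x' _ _ h h' => rw [add_mul]; exact Submodule.add_mem _ h h'
  | smul c x _ h => rw [smul_mul_assoc]; exact Submodule.smul_mem _ c h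

lemma solomonSpan_mul (x y : Submodule.span ℤ (Set.range (BlockWord.toF : BlockWord A → F A)))
    (h) : solomonSpan e ⟨x * y, h⟩ = solomonSpan e x * solomonSpan e y := by
  obtain ⟨z, hz⟩ := exists_solomonSpan_of_mem e
    (mul_mem_solomonGraph e (mem_solomonGraph e x) (mem_solomonGraph e y))
  obtain ⟨h1, h2⟩ := Prod.ext_iff.1 hz
  have h3 : z = ⟨x * y, h⟩ := Subtype.ext h1
  rw [← h3]
  exact h2

lemma of_mem_RepRing {n : ℕ} {f : FunComp G n} (hf : f ∈ virtualChars (Wreath G n)) :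
    DirectSum.of (FunComp G) n f ∈ RepRing G := by
  intro k
  by_cases h : k = n
  · subst h
    rwa [DirectSum.of_eq_same]
  · rw [DirectSum.of_eq_of_ne _ _ _ h]
    exact Submodule.zero_mem _

lemma solomonSpan_mem_RepRing
    (x : Submodule.span ℤ (Set.range (BlockWord.toF : BlockWord A → F A))) :
    solomonSpan e x ∈ RepRing G := by
  have : solomonGraph e ≤ (RepRing G).comap (LinearMap.snd ℤ (F A) (Fun G)) := by
    refine Submodule.span_le.2 ?_
    rintro _ ⟨d, rfl⟩
    exact of_mem_RepRing (youngInd_mem_virtualChars _ _)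
  exact this (mem_solomonGraph e x)

/-- The Solomon homomorphism. -/
def solomonHom : MR A →ₗ[ℤ] RepRing G :=
  (solomonSpan e ∘ₗ Submodule.inclusion BlockWord.MR_le_span_toF).codRestrict (RepRing G)
    fun _ => solomonSpan_mem_RepRing e _

lemma coe_solomonHom (x : MR A) :
    (solomonHom e x : Fun G) = solomonSpan e ⟨x, BlockWord.MR_le_span_toF x.2⟩ := rfl

lemma mem_solomonGraph_solomonHom (x : MR A) :
    ((x : F A), (solomonHom e x : Fun G)) ∈ solomonGraph e :=
  mem_solomonGraph e ⟨x, BlockWord.MR_le_span_toF x.2⟩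

lemma isSolomonHom_solomonHom : IsSolomonHom e (solomonHom e) where
  map_one := by rw [coe_solomonHom]; exact solomonSpan_one e _
  map_mul a b := by
    simp only [coe_solomonHom]
    exact solomonSpan_mul e ⟨a, BlockWord.MR_le_span_toF a.2⟩ ⟨b, BlockWord.MR_le_span_toF b.2⟩ _
  map_yGen n a _ := by rw [coe_solomonHom]; exact solomonSpan_yGen e n a _

variable {e}

lemma IsSolomonHom.unique {θ θ' : MR A →ₗ[ℤ] RepRing G} (h : IsSolomonHom e θ)
    (h' : IsSolomonHom e θ') : θ = θ' := by
  have key : MR A ≤ (LinearMap.eqLocus θ θ').map (MR A).subtype := by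
    refine sInf_le ⟨⟨?_, ?_⟩, ?_⟩
    · exact ⟨⟨1, one_mem_MR A⟩, Subtype.ext (h.map_one.trans h'.map_one.symm), rfl⟩
    · rintro _ ⟨a, ha, rfl⟩ _ ⟨b, hb, rfl⟩
      refine ⟨⟨a * b, mul_mem_MR a.2 b.2⟩, Subtype.ext ?_, rfl⟩
      have ha' : θ a = θ' a := ha
      have hb' : θ b = θ' b := hb
      rw [h.map_mul, h'.map_mul, ha', hb']
    · intro n v
      induction v using MonoidAlgebra.induction_linear with
      | zero => simp [yGen]
      | add x y hx hy =>
        rw [yGen, MonoidAlgebra.mapDomain_add, map_add]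
        exact Submodule.add_mem _ hx hy
      | single a r =>
        have hr : yGen n (MonoidAlgebra.single a r) = r • yGen n (MonoidAlgebra.single a 1) := by
          simp [yGen]
        rw [hr, map_zsmul]
        refine Submodule.smul_mem _ _ ?_
        -- The values on `y_{n,a}` are prescribed only for `n ≥ 1`; in degree zero `y_{0,a}` is the
        -- unit.
        rcases Nat.eq_zero_or_pos n with rfl | hn
        · rw [yGen_zero]
          exact ⟨⟨1, one_mem_MR A⟩, Subtype.ext (h.map_one.trans h'.map_one.symm), rfl⟩
        · exact ⟨⟨_, yGen_mem_MR n (MonoidAlgebra.single a 1)⟩,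
            Subtype.ext ((h.map_yGen n a hn).trans (h'.map_yGen n a hn).symm), rfl⟩
  refine LinearMap.ext fun x => ?_
  obtain ⟨y, hy, hyx⟩ := key x.2
  obtain rfl : y = x := Subtype.ext hyx
  exact hy

end Solomon

/-! ### The symmetry of the Solomon homomorphisms -/

section Pairing

lemma incl_apply {A : Type*} [Group A] {n : ℕ} (x : MRn A n) : ((incl x : MR A) : F A) n = x :=
  DirectSum.of_eq_same n (x : FComp A n)


lemma evalAt_zero_left {H : Type*} (x : MonoidAlgebra ℤ H) : evalAt (0 : H → ℂ) x = 0 := by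
  simp [evalAt]

lemma evalAt_zero_right {H : Type*} (f : H → ℂ) : evalAt f (0 : MonoidAlgebra ℤ H) = 0 := by
  simp [evalAt]

lemma evalAt_add_left {H : Type*} (f g : H → ℂ) (x : MonoidAlgebra ℤ H) :
    evalAt (f + g) x = evalAt f x + evalAt g x := by
  simp [evalAt, mul_add, Finsupp.sum_add]

lemma evalAt_add_right {H : Type*} (f : H → ℂ) (x y : MonoidAlgebra ℤ H) :
    evalAt f (x + y) = evalAt f x + evalAt f y := by
  classical
  rw [evalAt, MonoidAlgebra.coeff_add, Finsupp.sum_add_index'] <;> simp [evalAt, add_mul]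

lemma evalAt_smul_left {H : Type*} (c : ℤ) (f : H → ℂ) (x : MonoidAlgebra ℤ H) :
    evalAt (c • f) x = c * evalAt f x := by
  simp [evalAt, Finsupp.mul_sum, mul_left_comm]

lemma evalAt_smul_right {H : Type*} (c : ℤ) (f : H → ℂ) (x : MonoidAlgebra ℤ H) :
    evalAt f (c • x) = c * evalAt f x := by
  rw [evalAt, MonoidAlgebra.coeff_smul, Finsupp.sum_smul_index' (by simp), evalAt, Finsupp.mul_sum]
  simp [mul_assoc]

lemma evalAt_single {H : Type*} (f : H → ℂ) (h : H) :
    evalAt f (MonoidAlgebra.single h 1) = f h := by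
  simp [evalAt]

lemma evalAt_sum {H ι : Type*} (f : H → ℂ) (s : Finset ι) (x : ι → MonoidAlgebra ℤ H) :
    evalAt f (∑ i ∈ s, x i) = ∑ i ∈ s, evalAt f (x i) := by
  classical
  induction s using Finset.induction_on with
  | empty => simp [evalAt_zero_right]
  | insert i s hi ih => rw [Finset.sum_insert hi, Finset.sum_insert hi, evalAt_add_right, ih]

variable {G : Type*} [CommGroup G]

/-- At `ρ · a` the base component at `ρ p` is the letter `a p`; since `κ (ρ p) = κ p`, reindexing by
`ρ` removes the permutation from the weight. -/
lemma evalAt_youngInd_shuffleProd {n : ℕ} (χ : ℕ → G →* ℂˣ) (g : ℕ → G) (b d : Fin n → ℕ) :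
    evalAt (youngInd χ d) (shuffleProd b (g ∘ b)) =
      wordPairing (fun i j => (χ j (g i) : ℂ)) b d := by
  rw [shuffleProd, evalAt_sum, wordPairing]
  refine Finset.sum_congr rfl fun ρ _ => ?_
  rw [evalAt_single, youngInd]
  refine Finset.sum_congr rfl fun κ _ => ?_
  simp only [wordWeight, permWord_right, permWord_left]
  by_cases hκ : κ ∘ ρ = κ
  · rw [if_pos hκ, if_pos hκ, ← Equiv.prod_comp ρ]
    refine Finset.prod_congr rfl fun p _ => ?_
    rw [perm_inv_apply_self, show κ (ρ p) = κ p from congrFun hκ p]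
    rfl
  · rw [if_neg hκ, if_neg hκ]

variable [Finite G]

lemma evalAt_of_symm {m m' : ℕ} {b : Fin m → ℕ} {d : Fin m' → ℕ} (hb : Monotone b)
    (hd : Monotone d) (g : ℕ → G) (χ : ℕ → G →* ℂˣ) (n : ℕ) :
    evalAt (DirectSum.of (FunComp G) m' (youngInd χ d) n)
        (DirectSum.of (FComp G) m (shuffleProd b (g ∘ b)) n) =
      evalAt (DirectSum.of (FunComp (G →* ℂˣ)) m (youngInd (biduality G ∘ g) b) n)
        (DirectSum.of (FComp (G →* ℂˣ)) m' (shuffleProd d (χ ∘ d)) n) := by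
  by_cases hm : n = m
  · by_cases hm' : n = m'
    · subst hm hm'
      simp only [DirectSum.of_eq_same]
      rw [evalAt_youngInd_shuffleProd, evalAt_youngInd_shuffleProd, wordPairing_symm _ hb hd]
      simp only [Function.comp_apply, biduality_apply]
    · rw [DirectSum.of_eq_of_ne _ _ _ hm', DirectSum.of_eq_of_ne _ _ _ hm', evalAt_zero_left,
        evalAt_zero_right]
  · rw [DirectSum.of_eq_of_ne _ _ _ hm, DirectSum.of_eq_of_ne _ _ _ hm, evalAt_zero_left,
      evalAt_zero_right]

/-- Both sides are additive in each graph element, so a double span induction reduces to a pair of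
basis elements, where the symmetry of `wordPairing` applies. -/
lemma evalAt_symm_of_mem_solomonGraph {p : F G × Fun (G →* ℂˣ)} {q : F (G →* ℂˣ) × Fun G}
    (hp : p ∈ solomonGraph (biduality G)) (hq : q ∈ solomonGraph (MulEquiv.refl (G →* ℂˣ)))
    (n : ℕ) : evalAt (q.2 n) (p.1 n) = evalAt (p.2 n) (q.1 n) := by
  induction hp using Submodule.span_induction with
  | mem p hp =>
    obtain ⟨d, rfl⟩ := hp
    induction hq using Submodule.span_induction with
    | mem q hq =>
      obtain ⟨d', rfl⟩ := hq
      exact evalAt_of_symm d.monotone_block d'.monotone_block d.letter d'.letter n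
    | zero =>
      simp only [Prod.fst_zero, Prod.snd_zero, DirectSum.zero_apply, evalAt_zero_left,
        evalAt_zero_right]
    | add q q' _ _ h h' =>
      simp only [Prod.fst_add, Prod.snd_add, DirectSum.add_apply, evalAt_add_left,
        evalAt_add_right]
      exact congrArg₂ (· + ·) h h'
    | smul c q _ h =>
      simp only [Prod.smul_fst, Prod.smul_snd, DirectSum.smul_apply, evalAt_smul_left,
        evalAt_smul_right]
      exact congrArg _ h
  | zero =>
    simp only [Prod.fst_zero, Prod.snd_zero, DirectSum.zero_apply, evalAt_zero_left,
      evalAt_zero_right]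
  | add p p' _ _ h h' =>
    simp only [Prod.fst_add, Prod.snd_add, DirectSum.add_apply, evalAt_add_left,
      evalAt_add_right]
    exact congrArg₂ (· + ·) h h'
  | smul c p _ h =>
    simp only [Prod.smul_fst, Prod.smul_snd, DirectSum.smul_apply, evalAt_smul_left,
      evalAt_smul_right]
    exact congrArg _ h

lemma evalAt_solomonHom_symm (x : MR G) (y : MR (G →* ℂˣ)) (n : ℕ) :
    evalAt ((solomonHom (MulEquiv.refl (G →* ℂˣ)) y : Fun G) n) ((x : F G) n) =
      evalAt ((solomonHom (biduality G) x : Fun (G →* ℂˣ)) n) ((y : F (G →* ℂˣ)) n) := by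
  have hp := mem_solomonGraph_solomonHom (biduality G) x
  have hq := mem_solomonGraph_solomonHom (MulEquiv.refl (G →* ℂˣ)) y
  generalize (solomonHom (MulEquiv.refl (G →* ℂˣ)) y : Fun G) = g at hq ⊢
  generalize (solomonHom (biduality G) x : Fun (G →* ℂˣ)) = f at hp ⊢
  exact evalAt_symm_of_mem_solomonGraph hp hq n

end Pairing

end MantaciReutenauer

end

open MantaciReutenauer in
theorem mainTheorem2 (G : Type*) [CommGroup G] [Finite G] :
    (∃! θG : MR (G →* ℂˣ) →ₗ[ℤ] RepRing G, IsSolomonHom (MulEquiv.refl (G →* ℂˣ)) θG) ∧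
    (∃! θΓ : MR G →ₗ[ℤ] RepRing (G →* ℂˣ), IsSolomonHom (biduality G) θΓ) ∧
    ∀ (θG : MR (G →* ℂˣ) →ₗ[ℤ] RepRing G) (θΓ : MR G →ₗ[ℤ] RepRing (G →* ℂˣ)),
      IsSolomonHom (MulEquiv.refl (G →* ℂˣ)) θG →
      IsSolomonHom (biduality G) θΓ →
      ∀ n : ℕ, 1 ≤ n → ∀ (x : MRn G n) (y : MRn (G →* ℂˣ) n),
        evalAt ((θG (incl y) : Fun G) n) (x : FComp G n) =
          evalAt ((θΓ (incl x) : Fun (G →* ℂˣ)) n) (y : FComp (G →* ℂˣ) n) := by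
  refine ⟨⟨solomonHom _, isSolomonHom_solomonHom _, fun θ h => h.unique (isSolomonHom_solomonHom _)⟩,
    ⟨solomonHom _, isSolomonHom_solomonHom _, fun θ h => h.unique (isSolomonHom_solomonHom _)⟩, ?_⟩
  intro θG θΓ hG hΓ n _ x y
  obtain rfl := hG.unique (isSolomonHom_solomonHom _)
  obtain rfl := hΓ.unique (isSolomonHom_solomonHom _)
  have h := evalAt_solomonHom_symm (incl x) (incl y) n
  rw [incl_apply, incl_apply] at h
  exact h
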